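/- Let $F$ be a field with $F\neq\mathbb{F}_2$ (i.e. $F$ does not have exactly two elements), and let $n>1$ be an integer. Let $\mathcal P=\mathbb{P}^n_F=(F^{n+1}\setminus\{0\})/F^\times$ and, for distinct $\hat x,\hat y\in\mathcal P$, let $$\ell(\hat x,\hat y)=\{\hat z\in\mathcal P \mid \bar z=a\bar x+b\bar y \text{ for some } a,b\in F^\times\}\cup\{\hat x,\hat y\}$$ be the line through them; let $\mathcal L$ be the set of all these lines. One says that $(\mathcal P,\mathcal L)$ admits an incidence abelian group structure if there is an abelian group operation $\cdot$ on the set $\mathcal P$ such that, for every $a\in\mathcal P$, the translation $x\mapsto a\cdot x$ is part of a collineation: there is a bijection $\beta_a:\mathcal L\to\mathcal L$ with $\beta_a(\ell(x,y))=\ell(a\cdot x,a\cdot y)$ for all distinct $x,y\in\mathcal P$. A $\mathbf K$-vector space is a canonical hypergroup $(H,\boxplus,0)$ with $x\boxplus x=\{0,x\}$ for all $x\in H$; an isomorphism of $\mathbf K$-vector spaces is a bijection $\sigma$ with $\sigma(0)=0$ and $\sigma(x\boxplus y)=\sigma(x)\boxplus\sigma(y)$ for all $x,y$. The $\mathbf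 K$-vector space $H(\mathcal P,\mathcal L)$ associated to $(\mathcal P,\mathcal L)$ is the set $\mathcal P\cup\{0\}$, where $0\notin\mathcal P$, with $x\boxplus y=\ell(x,y)\setminus\{x,y\}$ and $x\boxplus x=\{0,x\}$ for distinct $x,y\in\mathcal P$, and $x\boxplus 0=0\boxplus x=\{x\}$ for all $x$. For a field extension $K|k$, the factor hyperfield $K_{k^\times}$ is the set of cosets $xk^\times$ ($x\in K$) with $xk^\times\cdot yk^\times=xyk^\times$ and $xk^\times\boxplus yk^\times=\{zk^\times\mid z=xt+ys \text{ for some } t,s\in k^\times\}$. **Theorem.** If $(\mathcal P,\mathcal L)$ admits an incidence abelian group structure, then there is a field extension $K|k$ of degree $n+1$ such that (the additive hypergroup of) the factor hyperfield $K_{k^\times}$ is a $\mathbf K$-vector space, $H(\mathcal P,\mathcal L)$ and $K_{k^\times}$ are isomorphic as $\mathbf K$-vector spaces, and $k$ and $F$ are isomorphic as fields. -/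

import Mathlib

universe u v

namespace IncidenceGroups

/-! ### Canonical hypergroups, `𝐊`-vector spaces and hyperfields -/

/-- A canonical hypergroup on the set `H`: a commutative associative multivalued operation `hadd`
with a neutral element, unique inverses and reversibility. -/
structure CanonicalHypergroup (H : Type u) where
  /-- the multivalued operation `x ⊞ y` -/
  hadd : H → H → Set H
  /-- the element `0` -/
  zero : H
  hadd_assoc : ∀ x y z : H, (⋃ a ∈ hadd x y, hadd a z) = ⋃ b ∈ hadd y z, hadd x b
  hadd_comm : ∀ x y : H, hadd x y = hadd y x
  exists_unique_neg : ∀ x : H, ∃! y : H, zero ∈ hadd x y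
  /-- here `x'` is the inverse of `x` -/
  reversible : ∀ x x' y z : H, zero ∈ hadd x x' → z ∈ hadd x y → y ∈ hadd z x'

/-- A canonical hypergroup is a vector space over the Krasner hyperfield `𝐊 = {0, 1}` when
`x ⊞ x = {0, x}` for all `x` (the scalar multiplication is then forced). -/
def CanonicalHypergroup.IsKVectorSpace {H : Type u} (X : CanonicalHypergroup H) : Prop :=
  ∀ x : H, X.hadd x x = {X.zero, x}

/-- Isomorphisms of canonical hypergroups. Between `𝐊`-vector spaces these are the isomorphisms of
`𝐊`-vector spaces. -/
structure CanonicalHypergroup.Iso {H : Type u} {H' : Type v}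
    (X : CanonicalHypergroup H) (Y : CanonicalHypergroup H') extends H ≃ H' where
  map_zero : toFun X.zero = Y.zero
  map_hadd : ∀ x y : H, toFun '' X.hadd x y = Y.hadd (toFun x) (toFun y)

/-- A (Krasner) hyperfield. The underlying canonical hypergroup `toCanonicalHypergroup` is its
additive hypergroup. -/
structure Hyperfield (H : Type u) extends CanonicalHypergroup H where
  mul : H → H → H
  one : H
  mul_assoc : ∀ x y z : H, mul (mul x y) z = mul x (mul y z)
  mul_comm : ∀ x y : H, mul x y = mul y x
  one_mul : ∀ x : H, mul one x = x
  zero_mul : ∀ x : H, mul zero x = zero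
  one_ne_zero : one ≠ zero
  exists_inv : ∀ x : H, x ≠ zero → ∃ y : H, mul x y = one
  distrib : ∀ x y z : H, mul x '' hadd y z = hadd (mul x y) (mul x z)

/-! ### Factor hyperfields -/

section Factor

variable (K : Type u) [Field K] (T : Subgroup Kˣ)

/-- The set of multiplicative cosets `xT`, for `x ∈ K` (including the coset `0T = {0}`). -/
abbrev Factor : Type u := MulAction.orbitRel.Quotient T K

variable {K}

/-- The coset `xT`. -/
def Factor.mk (x : K) : Factor K T := Quotient.mk _ x

variable {T}

theorem Factor.mk_eq_iff {x y : K} :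
    Factor.mk T x = Factor.mk T y ↔ ∃ t ∈ T, (t : K) * y = x := by
  unfold Factor.mk
  rw [Quotient.eq, MulAction.orbitRel_apply]
  constructor
  · rintro ⟨t, ht⟩
    exact ⟨t, t.2, ht⟩
  · rintro ⟨t, ht, h⟩
    exact ⟨⟨t, ht⟩, h⟩

theorem Factor.exists_rep (X : Factor K T) : ∃ x : K, Factor.mk T x = X :=
  Quotient.exists_rep X

theorem Factor.mk_eq_zero {x : K} : Factor.mk T x = Factor.mk T 0 ↔ x = 0 := by
  rw [Factor.mk_eq_iff]
  constructor
  · rintro ⟨t, _, h⟩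
    simpa using h.symm
  · rintro rfl
    exact ⟨1, T.one_mem, by simp⟩

variable (T)

/-- The hyperaddition `xT ⊞ yT = {zT | z = xt + ys for some t, s ∈ T}`. -/
def Factor.hadd (X Y : Factor K T) : Set (Factor K T) :=
  {Z | ∃ x y : K, Factor.mk T x = X ∧ Factor.mk T y = Y ∧ Factor.mk T (x + y) = Z}

variable {T}

theorem Factor.mem_hadd_mk {x y z : K} :
    Factor.mk T z ∈ Factor.hadd T (Factor.mk T x) (Factor.mk T y) ↔
      ∃ t ∈ T, ∃ s ∈ T, z = x * (t : K) + y * (s : K) := by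
  constructor
  · rintro ⟨x', y', hx, hy, hz⟩
    obtain ⟨t, ht, rfl⟩ := Factor.mk_eq_iff.1 hx
    obtain ⟨s, hs, rfl⟩ := Factor.mk_eq_iff.1 hy
    obtain ⟨r, hr, h⟩ := Factor.mk_eq_iff.1 hz.symm
    refine ⟨r * t, T.mul_mem hr ht, r * s, T.mul_mem hr hs, ?_⟩
    rw [← h]
    push_cast
    ring
  · rintro ⟨t, ht, s, hs, rfl⟩
    exact ⟨x * t, y * s, Factor.mk_eq_iff.2 ⟨t, ht, mul_comm _ _⟩,
      Factor.mk_eq_iff.2 ⟨s, hs, mul_comm _ _⟩, rfl⟩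

variable (T)

/-- The multiplication `xT · yT = xyT`. -/
def Factor.mul : Factor K T → Factor K T → Factor K T :=
  Quotient.map₂ (fun x y : K => x * y) (by
    rintro a b ⟨t, rfl⟩ c d ⟨s, rfl⟩
    refine ⟨t * s, ?_⟩
    simp only [Subgroup.smul_def, Units.smul_def, smul_eq_mul, Subgroup.coe_mul, Units.val_mul]
    ring)

variable {T}

theorem Factor.mul_mk (x y : K) :
    Factor.mul T (Factor.mk T x) (Factor.mk T y) = Factor.mk T (x * y) := rfl

/-- The factor hyperfield `K_T` of a field `K` modulo a subgroup `T` of `Kˣ`. -/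
def factorHyperfield (K : Type u) [Field K] (T : Subgroup Kˣ) : Hyperfield (Factor K T) where
  hadd := Factor.hadd T
  zero := Factor.mk T 0
  hadd_assoc X Y Z := by
    obtain ⟨x, rfl⟩ := X.exists_rep
    obtain ⟨y, rfl⟩ := Y.exists_rep
    obtain ⟨z, rfl⟩ := Z.exists_rep
    ext W
    obtain ⟨w, rfl⟩ := W.exists_rep
    simp only [Set.mem_iUnion, exists_prop]
    constructor
    · rintro ⟨A, hA, hW⟩
      obtain ⟨a, rfl⟩ := A.exists_rep
      obtain ⟨t, ht, s, hs, rfl⟩ := Factor.mem_hadd_mk.1 hA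
      obtain ⟨p, hp, q, hq, rfl⟩ := Factor.mem_hadd_mk.1 hW
      refine ⟨Factor.mk T (y * (s * p : Kˣ) + z * q),
        Factor.mem_hadd_mk.2 ⟨s * p, T.mul_mem hs hp, q, hq, rfl⟩,
        Factor.mem_hadd_mk.2 ⟨t * p, T.mul_mem ht hp, 1, T.one_mem, ?_⟩⟩
      push_cast
      ring
    · rintro ⟨A, hA, hW⟩
      obtain ⟨a, rfl⟩ := A.exists_rep
      obtain ⟨t, ht, s, hs, rfl⟩ := Factor.mem_hadd_mk.1 hA
      obtain ⟨p, hp, q, hq, rfl⟩ := Factor.mem_hadd_mk.1 hW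
      refine ⟨Factor.mk T (x * p + y * (t * q : Kˣ)),
        Factor.mem_hadd_mk.2 ⟨p, hp, t * q, T.mul_mem ht hq, rfl⟩,
        Factor.mem_hadd_mk.2 ⟨1, T.one_mem, s * q, T.mul_mem hs hq, ?_⟩⟩
      push_cast
      ring
  hadd_comm X Y := by
    ext Z
    constructor <;>
    · rintro ⟨x, y, hx, hy, hz⟩
      exact ⟨y, x, hy, hx, by rwa [add_comm]⟩
  exists_unique_neg X := by
    obtain ⟨x, rfl⟩ := X.exists_rep
    refine ⟨Factor.mk T (-x), ⟨x, -x, rfl, rfl, by simp⟩, ?_⟩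
    intro Y hY
    obtain ⟨y, rfl⟩ := Y.exists_rep
    obtain ⟨t, ht, s, hs, h⟩ := Factor.mem_hadd_mk.1 hY
    refine Factor.mk_eq_iff.2 ⟨t * s⁻¹, T.mul_mem ht (T.inv_mem hs), ?_⟩
    have hs0 : (s : K) ≠ 0 := s.ne_zero
    push_cast
    field_simp
    linear_combination h
  reversible X X' Y Z h hZ := by
    obtain ⟨x, rfl⟩ := X.exists_rep
    obtain ⟨x', rfl⟩ := X'.exists_rep
    obtain ⟨y, rfl⟩ := Y.exists_rep
    obtain ⟨z, rfl⟩ := Z.exists_rep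
    obtain ⟨t, ht, s, hs, h⟩ := Factor.mem_hadd_mk.1 h
    obtain ⟨p, hp, q, hq, rfl⟩ := Factor.mem_hadd_mk.1 hZ
    refine Factor.mem_hadd_mk.2 ⟨q⁻¹, T.inv_mem hq, s * t⁻¹ * p * q⁻¹,
      T.mul_mem (T.mul_mem (T.mul_mem hs (T.inv_mem ht)) hp) (T.inv_mem hq), ?_⟩
    have ht0 : (t : K) ≠ 0 := t.ne_zero
    have hq0 : (q : K) ≠ 0 := q.ne_zero
    push_cast
    field_simp
    linear_combination (p : K) * h
  mul := Factor.mul T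
  one := Factor.mk T 1
  mul_assoc X Y Z := by
    obtain ⟨x, rfl⟩ := X.exists_rep
    obtain ⟨y, rfl⟩ := Y.exists_rep
    obtain ⟨z, rfl⟩ := Z.exists_rep
    simp only [Factor.mul_mk, mul_assoc]
  mul_comm X Y := by
    obtain ⟨x, rfl⟩ := X.exists_rep
    obtain ⟨y, rfl⟩ := Y.exists_rep
    simp only [Factor.mul_mk, mul_comm]
  one_mul X := by
    obtain ⟨x, rfl⟩ := X.exists_rep
    simp only [Factor.mul_mk, one_mul]
  zero_mul X := by
    obtain ⟨x, rfl⟩ := X.exists_rep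
    simp only [Factor.mul_mk, zero_mul]
  one_ne_zero := by
    rw [Ne, Factor.mk_eq_zero]
    exact one_ne_zero
  exists_inv X hX := by
    obtain ⟨x, rfl⟩ := X.exists_rep
    rw [Ne, Factor.mk_eq_zero] at hX
    exact ⟨Factor.mk T x⁻¹, by rw [Factor.mul_mk, mul_inv_cancel₀ hX]⟩
  distrib X Y Z := by
    obtain ⟨x, rfl⟩ := X.exists_rep
    obtain ⟨y, rfl⟩ := Y.exists_rep
    obtain ⟨z, rfl⟩ := Z.exists_rep
    ext W
    obtain ⟨w, rfl⟩ := W.exists_rep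
    simp only [Factor.mul_mk, Set.mem_image]
    constructor
    · rintro ⟨A, hA, hW⟩
      obtain ⟨a, rfl⟩ := A.exists_rep
      obtain ⟨t, ht, s, hs, rfl⟩ := Factor.mem_hadd_mk.1 hA
      rw [← hW, Factor.mul_mk]
      exact Factor.mem_hadd_mk.2 ⟨t, ht, s, hs, by ring⟩
    · intro hW
      obtain ⟨t, ht, s, hs, rfl⟩ := Factor.mem_hadd_mk.1 hW
      exact ⟨Factor.mk T (y * t + z * s), Factor.mem_hadd_mk.2 ⟨t, ht, s, hs, rfl⟩,
        by rw [Factor.mul_mk]; congr 1; ring⟩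

/-- For a field extension `K|k`, the subgroup `kˣ` of `Kˣ`. -/
def baseUnits (k K : Type u) [Field k] [Field K] [Algebra k K] : Subgroup Kˣ :=
  (Units.map (algebraMap k K : k →* K)).range

end Factor

/-! ### The projective geometry of a vector space -/

section Projective

variable (F : Type u) [Field F] (V : Type v) [AddCommGroup V] [Module F V]

variable {F V}

/-- The line `ℓ(x, y)` through two distinct points `x`, `y` of `ℙ(V)`. -/
def line (x y : Projectivization F V) : Set (Projectivization F V) :=
  {z | ∃ a b : Fˣ, z.rep = a • x.rep + b • y.rep} ∪ {x, y}

variable (F V)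

/-- The set of lines of the projective geometry of `ℙ(V)`. -/
def lines : Set (Set (Projectivization F V)) :=
  {l | ∃ x y : Projectivization F V, x ≠ y ∧ l = line x y}

variable {F V}

/-- The pair `(α, β)` is a collineation of the projective geometry of `ℙ(V)` with itself. -/
def IsCollineation (α : Projectivization F V → Projectivization F V)
    (β : lines F V → lines F V) : Prop :=
  Function.Bijective α ∧ Function.Bijective β ∧
    ∀ (x y : Projectivization F V) (h : x ≠ y),
      line (α x) (α y) = (β ⟨line x y, x, y, h, rfl⟩ : Set (Projectivization F V))

variable (F V)

/-- The projective geometry of `ℙ(V)` admits an incidence abelian group structure: there is an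
abelian group structure on the set of points all of whose translations `x ↦ a * x` are
collineations. (The map `β` on lines is determined: it sends `ℓ(x, y)` to `ℓ(a * x, a * y)`.) -/
def AdmitsIncidenceAbelianGroup : Prop :=
  ∃ _ : CommGroup (Projectivization F V), ∀ a : Projectivization F V,
    ∃ β : lines F V → lines F V, IsCollineation (fun x => a * x) β

variable {F V}

open Classical in
/-- The hyperoperation on the set `ℙ(V) ∪ {0}`; the new point `0` is `none`. -/
noncomputable def projHadd :
    Option (Projectivization F V) → Option (Projectivization F V) →
      Set (Option (Projectivization F V))
  | none, y => {y}
  | some x, none => {some x}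
  | some x, some y => if x = y then {none, some x} else some '' (line x y \ {x, y})

/-- An auxiliary representative in `V` of an element of `ℙ(V) ∪ {0}`. -/
noncomputable def optRep : Option (Projectivization F V) → V
  | none => 0
  | some x => x.rep

theorem exists_optRep (v : V) :
    ∃ (x : Option (Projectivization F V)) (a : Fˣ), optRep x = a • v := by
  by_cases hv : v = 0
  · exact ⟨none, 1, by simp [optRep, hv]⟩
  · obtain ⟨a, ha⟩ := Projectivization.exists_smul_eq_mk_rep F v hv
    exact ⟨some (Projectivization.mk F v hv), a, ha.symm⟩

theorem optRep_eq_of_smul {x y : Option (Projectivization F V)} (a : Fˣ)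
    (h : optRep x = a • optRep y) : x = y := by
  cases x with
  | none =>
    cases y with
    | none => rfl
    | some y => exact absurd ((smul_eq_zero_iff_eq a).1 h.symm) y.rep_nonzero
  | some x =>
    cases y with
    | none => exact absurd (by simpa [optRep] using h) x.rep_nonzero
    | some y =>
      rw [← x.mk_rep, ← y.mk_rep]
      congr 1
      exact (Projectivization.mk_eq_mk_iff F _ _ x.rep_nonzero y.rep_nonzero).2 ⟨a, h.symm⟩

theorem exists_units_add_eq_one (hF : Nat.card F ≠ 2) : ∃ a b : Fˣ, (a : F) + b = 1 := by
  by_contra! hcon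
  refine hF ?_
  have h01 : ∀ x : F, x = 0 ∨ x = 1 := by
    intro x
    by_contra! hx
    exact hcon (Units.mk0 x hx.1) (Units.mk0 (1 - x) (sub_ne_zero.2 (Ne.symm hx.2))) (by simp)
  have huniv : (Set.univ : Set F) = {0, 1} := by
    ext x
    simpa using h01 x
  rw [← Set.ncard_univ, huniv, Set.ncard_pair zero_ne_one]

theorem eq_of_smul_add_smul_eq_zero {x y : Projectivization F V} (a : F) (c : Fˣ)
    (h : a • x.rep + c • y.rep = 0) : x = y := by
  have ha : a ≠ 0 := by
    rintro rfl
    rw [zero_smul, zero_add, smul_eq_zero_iff_eq] at h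
    exact y.rep_nonzero h
  have h' : optRep (some x) = (-((Units.mk0 a ha)⁻¹ * c)) • optRep (some y) := by
    have h1 : (Units.mk0 a ha) • x.rep = -(c • y.rep) := eq_neg_of_add_eq_zero_left h
    change x.rep = _ • y.rep
    rw [Units.neg_smul, mul_smul, ← smul_neg, ← h1, inv_smul_smul]
  exact Option.some.inj (optRep_eq_of_smul _ h')

theorem mem_projHadd (hF : Nat.card F ≠ 2) {x y z : Option (Projectivization F V)} :
    z ∈ projHadd x y ↔ ∃ a b : Fˣ, optRep z = a • optRep x + b • optRep y := by
  cases x with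
  | none =>
    constructor
    · intro h
      obtain rfl : z = y := by simpa [projHadd] using h
      exact ⟨1, 1, by simp [optRep]⟩
    · rintro ⟨a, b, h⟩
      have : z = y := optRep_eq_of_smul b (by simpa [optRep] using h)
      simpa [projHadd] using this
  | some x =>
    cases y with
    | none =>
      constructor
      · intro h
        obtain rfl : z = some x := by simpa [projHadd] using h
        exact ⟨1, 1, by simp [optRep]⟩
      · rintro ⟨a, b, h⟩
        have : z = some x := optRep_eq_of_smul a (by simpa [optRep] using h)
        simpa [projHadd] using this
    | some y =>
      by_cases hxy : x = y
      · subst hxy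
        simp only [projHadd, if_true, Set.mem_insert_iff, Set.mem_singleton_iff]
        constructor
        · rintro (rfl | rfl)
          · exact ⟨1, -1, by simp [optRep]⟩
          · obtain ⟨a, b, hab⟩ := exists_units_add_eq_one hF
            refine ⟨a, b, ?_⟩
            rw [Units.smul_def, Units.smul_def, ← add_smul, hab, one_smul]
        · rintro ⟨a, b, h⟩
          rw [Units.smul_def, Units.smul_def, ← add_smul] at h
          by_cases hab : (a : F) + b = 0
          · left
            rw [hab, zero_smul] at h
            exact optRep_eq_of_smul (y := none) 1 (by simpa [optRep] using h)
          · right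
            exact optRep_eq_of_smul (Units.mk0 _ hab) h
      · simp only [projHadd, if_neg hxy]
        constructor
        · rintro ⟨w, ⟨hw | hw, hw'⟩, rfl⟩
          · exact hw
          · exact absurd hw hw'
        · rintro ⟨a, b, h⟩
          cases z with
          | none => exact absurd (eq_of_smul_add_smul_eq_zero (a : F) b h.symm) hxy
          | some w =>
            refine ⟨w, ⟨Or.inl ⟨a, b, h⟩, ?_⟩, rfl⟩
            change w.rep = a • x.rep + b • y.rep at h
            rintro (rfl | hw)
            · refine hxy (eq_of_smul_add_smul_eq_zero ((a : F) - 1) b ?_)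
              rw [sub_smul, one_smul]
              nth_rewrite 2 [h]
              rw [Units.smul_def]
              abel
            · obtain rfl : w = y := hw
              refine hxy (eq_of_smul_add_smul_eq_zero ((b : F) - 1) a ?_).symm
              rw [sub_smul, one_smul]
              nth_rewrite 2 [h]
              rw [Units.smul_def b]
              abel

variable (V)

/-- The canonical hypergroup `H(𝒫, ℒ)` associated to the projective geometry of `ℙ(V)`, for a vector
space `V` over a field `F ≠ 𝔽₂`. Its underlying set is `ℙ(V) ∪ {0}`, with
`x ⊞ y = ℓ(x, y) \ {x, y}` and `x ⊞ x = {0, x}` for distinct `x, y ∈ ℙ(V)`. -/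
noncomputable def projHypergroup (hF : Nat.card F ≠ 2) :
    CanonicalHypergroup (Option (Projectivization F V)) where
  hadd := projHadd
  zero := none
  hadd_assoc x y z := by
    ext w
    simp only [Set.mem_iUnion, exists_prop, mem_projHadd hF]
    constructor
    · rintro ⟨u, ⟨a, b, hu⟩, c, d, hw⟩
      obtain ⟨t, e, ht⟩ := exists_optRep (F := F) ((c * b) • optRep y + d • optRep z)
      refine ⟨t, ⟨e * (c * b), e * d, ?_⟩, c * a, e⁻¹, ?_⟩
      · rw [ht, smul_add, smul_smul, smul_smul e d]
      · rw [hw, hu, ht, inv_smul_smul, smul_add, smul_smul, smul_smul, add_assoc]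
    · rintro ⟨u, ⟨a, b, hu⟩, c, d, hw⟩
      obtain ⟨t, e, ht⟩ := exists_optRep (F := F) (c • optRep x + (d * a) • optRep y)
      refine ⟨t, ⟨e * c, e * (d * a), ?_⟩, e⁻¹, d * b, ?_⟩
      · rw [ht, smul_add, smul_smul, smul_smul e (d * a)]
      · rw [hw, hu, ht, inv_smul_smul, smul_add, smul_smul, smul_smul, add_assoc]
  hadd_comm x y := by
    ext z
    simp only [mem_projHadd hF]
    constructor <;>
    · rintro ⟨a, b, h⟩
      exact ⟨b, a, by rw [h, add_comm]⟩
  exists_unique_neg x := by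
    refine ⟨x, (mem_projHadd hF).2 ⟨1, -1, by simp [optRep]⟩, ?_⟩
    intro y hy
    obtain ⟨a, b, h⟩ := (mem_projHadd hF).1 hy
    have h1 : b • optRep y = -(a • optRep x) := eq_neg_of_add_eq_zero_right h.symm
    refine optRep_eq_of_smul (-(b⁻¹ * a)) ?_
    rw [Units.neg_smul, mul_smul, ← smul_neg, ← h1, inv_smul_smul]
  reversible x x' y z h hz := by
    obtain ⟨a, b, h⟩ := (mem_projHadd hF).1 h
    obtain ⟨c, d, hz⟩ := (mem_projHadd hF).1 hz
    have h1 : a • optRep x = -(b • optRep x') := eq_neg_of_add_eq_zero_left h.symm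
    refine (mem_projHadd hF).2 ⟨d⁻¹, d⁻¹ * c * a⁻¹ * b, ?_⟩
    have h2 : optRep x = -((a⁻¹ * b) • optRep x') := by
      rw [mul_smul, ← smul_neg, ← h1, inv_smul_smul]
    rw [hz, h2, smul_add, inv_smul_smul, smul_neg, smul_neg, smul_smul, smul_smul]
    simp only [mul_assoc]
    abel

/-- `H(𝒫, ℒ)` is a `𝐊`-vector space. -/
theorem projHypergroup_isKVectorSpace (hF : Nat.card F ≠ 2) :
    (projHypergroup V hF).IsKVectorSpace := by
  rintro (_ | x)
  · simp [projHypergroup, projHadd]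
  · simp [projHypergroup, projHadd]

end Projective

end IncidenceGroups

/-! Since `n > 1`, the fundamental theorem of projective geometry applies to the translations. Fix a
vector `1` representing the neutral point. For every nonzero vector `w`, the translation by its
class lifts to a semilinear map `v ↦ w * v`, scaled so that `w * 1 = w`; put `0 * v = 0`. A lift is
determined by its projective map and its value at `1`, so the product is associative. It is additive
in the second factor, but commutative only up to scalars, and additivity in the first factor is not
yet known.

Translations act freely, so `w` has no eigenvector unless it lies on the line `F · 1`. Commutativity
up to scalars gives `(1 + w) * x ∼ x * (1 + w) = x + x * w`, hence `(1 + w) * x = f • x + g • (w *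
x)` with nonzero `f`, `g` depending on `x`. For `w ∉ F · 1` this local relation does two things. It
forces the field endomorphism attached to `w` to be the identity (`ringHom_eq_id_of_triple` and
`ringHom_eq_id_of_quadruple`, joined in `σ_eq`). Then it forces `(1 + w) * y = y + w * y`, because
the linear difference of the two sides lies locally in the span of `y` and `w * y` and kills `1`
(`eq_zero_of_map_eq_zero`). Comparing coefficients gives `w * y = y * w`.

Commutativity then extends to all of `V`, the product is bilinear, and `V` becomes a field of degree
`n + 1` over `F`. Points of the geometry are the nonzero cosets modulo `Fˣ`, and both hyperadditions
are described by sums `a • x + b • y` with units `a`, `b`. -/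

namespace IncidenceGroups

open Submodule

/-! ### Independence of two and of three vectors -/

section LinearIndependence

variable {F : Type u} [Field F] {V : Type v} [AddCommGroup V] [Module F V]

theorem mem_span_of_smul_eq {x y : V} {a b : F} (hb : b ≠ 0) (h : a • x + b • y = 0) :
    y ∈ span F {x} := by
  refine mem_span_singleton.2 ⟨-(b⁻¹ * a), ?_⟩
  have : b⁻¹ • (a • x + b • y) = 0 := by rw [h, smul_zero]
  rw [smul_add, smul_smul, smul_smul, inv_mul_cancel₀ hb, one_smul] at this
  rw [neg_smul]
  exact (eq_neg_of_add_eq_zero_right this).symm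

theorem eq_zero_of_pair {x y : V} (hx : x ≠ 0) (hy : y ∉ span F {x}) {a b : F}
    (h : a • x + b • y = 0) : a = 0 ∧ b = 0 := by
  have hb : b = 0 := by
    by_contra hb
    exact hy (mem_span_of_smul_eq hb h)
  subst hb
  rw [zero_smul, add_zero, smul_eq_zero] at h
  exact ⟨h.resolve_right hx, rfl⟩

theorem eq_zero_of_triple {x y z : V} (hx : x ≠ 0) (hy : y ∉ span F {x})
    (hz : z ∉ span F {x, y}) {a b c : F} (h : a • x + b • y + c • z = 0) :
    a = 0 ∧ b = 0 ∧ c = 0 := by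
  have hc : c = 0 := by
    by_contra hc
    refine hz (mem_span_pair.2 ⟨-(c⁻¹ * a), -(c⁻¹ * b), ?_⟩)
    have : c⁻¹ • (a • x + b • y + c • z) = 0 := by rw [h, smul_zero]
    rw [smul_add, smul_add, smul_smul, smul_smul, smul_smul, inv_mul_cancel₀ hc, one_smul] at this
    rw [neg_smul, neg_smul, ← neg_add]
    exact (eq_neg_of_add_eq_zero_right this).symm
  subst hc
  rw [zero_smul, add_zero] at h
  exact ⟨(eq_zero_of_pair hx hy h).1, (eq_zero_of_pair hx hy h).2, rfl⟩

theorem smul_mem_span_singleton (a : F) (x : V) : a • x ∈ span F {x} :=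
  mem_span_singleton.2 ⟨a, rfl⟩

theorem smul_add_smul_mem_span_pair (a b : F) (x y : V) : a • x + b • y ∈ span F {x, y} :=
  mem_span_pair.2 ⟨a, b, rfl⟩

theorem span_singleton_le_span_pair (x y : V) : span F {x} ≤ span F {x, y} :=
  span_mono (by simp)

theorem add_notMem_span_singleton {x y : V} (h : y ∉ span F {x}) (a : F) :
    a • x + y ∉ span F {x} := by
  rwa [Submodule.add_mem_iff_right _ (smul_mem_span_singleton a x)]

end LinearIndependence

/-! ### Additive maps that preserve lines: existence of the scalar twist, and uniqueness -/

section Semilinear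

variable {F : Type u} [Field F] {V : Type v} [AddCommGroup V] [Module F V]
  {M : Type v} [AddCommGroup M] [Module F M]

/-- An additive map of a space of dimension at least two that maps lines into lines and preserves
independence is semilinear. -/
theorem exists_ringHom_of_map_smul (hM : ∀ x : M, ∃ y, y ∉ span F {x}) (H : M →+ V)
    (hH : ∀ (c : F) (v : M), ∃ s : F, H (c • v) = s • H v)
    (hind : ∀ u v : M, u ≠ 0 → v ∉ span F {u} → H u ≠ 0 ∧ H v ∉ span F {H u}) :
    ∃ σ : F →+* F, ∀ (c : F) (v : M), H (c • v) = σ c • H v := by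
  -- Expanding `H (c • (u + v))` in the independent vectors `H u`, `H v` shows that `u` and `v` are
  -- scaled by the same factor.
  have key : ∀ (c : F) (u v : M) (s : F), u ≠ 0 → v ∉ span F {u} → H (c • u) = s • H u →
      H (c • v) = s • H v := by
    intro c u v s hu hv hs
    obtain ⟨s', hs'⟩ := hH c v
    obtain ⟨r, hr⟩ := hH c (u + v)
    obtain ⟨h1, h2⟩ := hind u v hu hv
    rw [smul_add, map_add, map_add, hs, hs'] at hr
    have := eq_zero_of_pair h1 h2 (a := s - r) (b := s' - r) (by
      linear_combination (norm := module) hr)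
    rw [hs', sub_eq_zero.1 this.1, sub_eq_zero.1 this.2]
  obtain ⟨e, he⟩ := hM 0
  have he0 : e ≠ 0 := by rintro rfl; simp at he
  obtain ⟨t, ht⟩ := hM e
  have ht0 : t ≠ 0 := by rintro rfl; simp at ht
  have hHe : H e ≠ 0 := (hind e t he0 ht).1
  choose s hs using fun c => hH c e
  have hs' : ∀ c v, H (c • v) = s c • H v := by
    intro c v
    by_cases hv : v ∈ span F {e}
    · obtain ⟨a, rfl⟩ := mem_span_singleton.1 hv
      by_cases ha : a = 0
      · simp [ha]
      refine key c t (a • e) (s c) ht0 ?_ (key c e t (s c) he0 ht (hs c))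
      intro h
      obtain ⟨b, hb⟩ := mem_span_singleton.1 h
      refine he0 ?_
      have := eq_zero_of_pair he0 ht (a := a) (b := -b) (by rw [← hb]; module)
      exact absurd this.1 ha
    · exact key c e v (s c) he0 hv (hs c)
  have hinj : ∀ a b : F, a • H e = b • H e → a = b := fun a b h => smul_left_injective F hHe h
  refine ⟨{ toFun := s, map_one' := ?_, map_mul' := ?_, map_zero' := ?_, map_add' := ?_ }, hs'⟩
  · exact hinj _ _ (by rw [← hs, one_smul, one_smul])
  · intro c d
    exact hinj _ _ (by rw [← hs, mul_smul, hs', hs, smul_smul])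
  · exact hinj _ _ (by rw [← hs, zero_smul, zero_smul, map_zero])
  · intro c d
    exact hinj _ _ (by rw [← hs, add_smul, map_add, hs, hs, add_smul])

/-- Two additive maps inducing the same projective map and agreeing at one nonzero vector are
equal. -/
theorem addMonoidHom_eq_of_forall_smul (hM : ∀ x : M, ∃ y, y ∉ span F {x}) (H H' : M →+ V)
    (h : ∀ v, ∃ s : F, H' v = s • H v)
    (hind : ∀ u v : M, u ≠ 0 → v ∉ span F {u} → H u ≠ 0 ∧ H v ∉ span F {H u})
    {e : M} (he : e ≠ 0) (heq : H' e = H e) : H' = H := by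
  have key : ∀ v, v ∉ span F {e} → H' v = H v := by
    intro v hv
    obtain ⟨s, hs⟩ := h v
    obtain ⟨r, hr⟩ := h (e + v)
    obtain ⟨h1, h2⟩ := hind e v he hv
    rw [map_add, map_add, hs, heq] at hr
    have := eq_zero_of_pair h1 h2 (a := 1 - r) (b := s - r) (by
      linear_combination (norm := module) hr)
    rw [hs, sub_eq_zero.1 this.2, ← sub_eq_zero.1 this.1, one_smul]
  ext v
  by_cases hv : v ∈ span F {e}
  · obtain ⟨t, ht⟩ := hM e
    have h1 := key (v + t) (by rwa [Submodule.add_mem_iff_right _ hv])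
    rwa [map_add, map_add, key t ht, add_left_inj] at h1
  · exact key v hv

end Semilinear

/-! ### The fundamental theorem of projective geometry -/

section FundamentalTheorem

variable {F : Type u} [Field F] {V : Type v} [AddCommGroup V] [Module F V]

/-- The fundamental theorem of projective geometry, for maps given on representing vectors. -/
theorem exists_semilinear_lift (hV : ∀ x y : V, ∃ z, z ∉ span F {x, y}) (φ : V → V)
    (hφ0 : φ 0 = 0) (hφ : ∀ x y z, z ∈ span F {x, y} ↔ φ z ∈ span F {φ x, φ y}) :
    ∃ (H : V →+ V) (σ : F →+* F), (∀ (c : F) (v : V), H (c • v) = σ c • H v) ∧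
      ∀ v, ∃ c : F, c ≠ 0 ∧ H v = c • φ v := by
  have hφ1 : ∀ x z, z ∈ span F {x} ↔ φ z ∈ span F {φ x} := by
    intro x z
    simpa using hφ x x z
  have hφz : ∀ x, φ x = 0 ↔ x = 0 := by
    intro x
    simpa [hφ0] using (hφ1 0 x).symm
  obtain ⟨z₀, hz₀⟩ := hV 0 0
  obtain ⟨e, he⟩ : ∃ e : V, e ≠ 0 := ⟨z₀, by rintro rfl; simp at hz₀⟩
  have hφe : φ e ≠ 0 := (hφz e).not.2 he
  obtain ⟨W, hW⟩ := Submodule.exists_isCompl (span F {e})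
  have hWe : ∀ v ∈ W, v ∈ span F {e} → v = 0 := fun v hv hv' =>
    Submodule.disjoint_def.1 hW.disjoint v hv' hv
  -- On a complement `W` of the line of `e`, the point of `e + v` fixes the scale: `h v` is the
  -- multiple of `φ v` for which `φ e + h v` represents the image of `e + v`.
  have ex : ∀ v : W, ∃ w : V, (∃ c : F, c ≠ 0 ∧ w = c • φ v) ∧
      ∃ a : F, a ≠ 0 ∧ φ (e + v) = a • (φ e + w) := by
    intro v
    by_cases hv : v = 0
    · subst hv
      exact ⟨0, ⟨1, one_ne_zero, by simp [hφ0]⟩, 1, one_ne_zero, by simp⟩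
    have hv0 : (v : V) ≠ 0 := by simpa using hv
    have hve : (v : V) ∉ span F {e} := fun h => hv0 (hWe v v.2 h)
    have h1 : φ (e + v) ∈ span F {φ e, φ (v : V)} :=
      (hφ _ _ _).1 (mem_span_pair.2 ⟨1, 1, by simp⟩)
    obtain ⟨a, b, hab⟩ := mem_span_pair.1 h1
    have ha : a ≠ 0 := by
      rintro rfl
      have h2 : e + (v : V) ∈ span F {(v : V)} :=
        (hφ1 _ _).2 (mem_span_singleton.2 ⟨b, by rw [← hab]; simp⟩)
      obtain ⟨c, hc⟩ := mem_span_singleton.1 h2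
      exact one_ne_zero (eq_zero_of_pair he hve (a := (1 : F)) (b := 1 - c)
        (by rw [sub_smul, hc]; module)).1
    have hb : b ≠ 0 := by
      rintro rfl
      have h2 : e + (v : V) ∈ span F {e} :=
        (hφ1 _ _).2 (mem_span_singleton.2 ⟨a, by rw [← hab]; simp⟩)
      refine hve ?_
      rwa [Submodule.add_mem_iff_right _ (mem_span_singleton_self e)] at h2
    refine ⟨(a⁻¹ * b) • φ v, ⟨_, mul_ne_zero (inv_ne_zero ha) hb, rfl⟩, a, ha, ?_⟩
    rw [smul_add, smul_smul, mul_inv_cancel_left₀ ha, hab]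
  choose h hc ha using ex
  have h_zero : h 0 = 0 := by
    obtain ⟨c, -, hc⟩ := hc 0
    rw [hc, ZeroMemClass.coe_zero, hφ0, smul_zero]
  have h_mem : ∀ x y z : W, (z : V) ∈ span F {(x : V), (y : V)} → h z ∈ span F {h x, h y} := by
    intro x y z hz
    obtain ⟨a, b, hab⟩ := mem_span_pair.1 ((hφ _ _ _).1 hz)
    obtain ⟨c1, h1, h1'⟩ := hc x
    obtain ⟨c2, h2, h2'⟩ := hc y
    obtain ⟨c3, h3, h3'⟩ := hc z
    rw [h1', h2', h3', ← hab]
    refine mem_span_pair.2 ⟨c3 * a * c1⁻¹, c3 * b * c2⁻¹, ?_⟩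
    rw [smul_smul, smul_smul, mul_assoc _ c1⁻¹, mul_assoc _ c2⁻¹, inv_mul_cancel₀ h1,
      inv_mul_cancel₀ h2]
    module
  have h_ne : ∀ u : W, u ≠ 0 → h u ≠ 0 := by
    intro u hu
    obtain ⟨c, h1, h2⟩ := hc u
    rw [h2]
    exact smul_ne_zero h1 ((hφz _).not.2 (by simpa using hu))
  have span_h : ∀ u : W, span F {h u} = span F {φ u} := by
    intro u
    obtain ⟨c, h1, h2⟩ := hc u
    rw [h2]
    exact span_singleton_smul_eq (IsUnit.mk0 c h1) _
  have h_e : ∀ u : W, u ≠ 0 → h u ∉ span F {φ e} := by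
    intro u hu hmem
    have : φ u ∈ span F {φ e} := by
      have h3 : span F {h u} ≤ span F {φ e} := by simpa using hmem
      rw [span_h] at h3
      exact h3 (mem_span_singleton_self _)
    exact hu (by simpa using hWe u u.2 ((hφ1 _ _).2 this))
  have h_ind : ∀ u v : W, u ≠ 0 → (v : V) ∉ span F {(u : V)} → h v ∉ span F {φ e, h u} := by
    intro u v hu hv hmem
    obtain ⟨a, b, hab⟩ := mem_span_pair.1 hmem
    obtain ⟨c1, h1, h1'⟩ := hc u
    obtain ⟨c2, h2, h2'⟩ := hc v
    have : φ v ∈ span F {φ e, φ u} := by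
      refine mem_span_pair.2 ⟨c2⁻¹ * a, c2⁻¹ * b * c1, ?_⟩
      have : φ (v : V) = c2⁻¹ • h v := by rw [h2', inv_smul_smul₀ h2]
      rw [this, ← hab, h1']
      module
    obtain ⟨p, q, hpq⟩ := mem_span_pair.1 ((hφ _ _ _).2 this)
    refine hv (mem_span_singleton.2 ⟨q, ?_⟩)
    have h3 : (v : V) - q • (u : V) = 0 := by
      refine hWe _ (W.sub_mem v.2 (W.smul_mem _ u.2)) (mem_span_singleton.2 ⟨p, ?_⟩)
      rw [← hpq]
      module
    exact (sub_eq_zero.1 h3).symm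
  have h_add : ∀ u v : W, (v : V) ∉ span F {(u : V)} → h (u + v) = h u + h v := by
    intro u v hv
    by_cases hu : u = 0
    · rw [hu, zero_add, h_zero, zero_add]
    have i3 := fun (a b c : F) (heq : a • φ e + b • h u + c • h v = 0) =>
      eq_zero_of_triple hφe (h_e u hu) (h_ind u v hu hv) heq
    -- The vector `e + x + y` lies in the span of `e + x` and `y`. Using this for `(u, v)` and for
    -- `(v, u)` gives two expansions in `φ e`, `h u`, `h v`, whose coefficients must agree.
    have aux : ∀ x y : W, ∃ p q : F, φ e + h (x + y) = p • (φ e + h x) + q • h y := by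
      intro x y
      obtain ⟨a, b, hab⟩ := mem_span_pair.1 ((hφ (e + x) y (e + (x + y : W))).1
        (mem_span_pair.2 ⟨1, 1, by push_cast; module⟩))
      obtain ⟨a1, h1, h1'⟩ := ha (x + y)
      obtain ⟨a2, h2, h2'⟩ := ha x
      obtain ⟨c, h3, h3'⟩ := hc y
      refine ⟨a1⁻¹ * a * a2, a1⁻¹ * b * c⁻¹, ?_⟩
      have e1 : φ e + h (x + y) = a1⁻¹ • φ (e + (x + y : W)) := by rw [h1', inv_smul_smul₀ h1]
      have e2 : φ (y : V) = c⁻¹ • h y := by rw [h3', inv_smul_smul₀ h3]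
      rw [e1, ← hab, h2', e2]
      module
    obtain ⟨p, q, hpq⟩ := aux u v
    obtain ⟨r, s, hrs⟩ := aux v u
    rw [add_comm v u, hpq] at hrs
    obtain ⟨k1, k2, k3⟩ := i3 (p - r) (p - s) (q - r) (by linear_combination (norm := module) hrs)
    -- Since `h (u + v)` has no component along `φ e`, the common coefficient is `1`.
    obtain ⟨m, n, hmn⟩ := mem_span_pair.1
      (h_mem u v (u + v) (mem_span_pair.2 ⟨1, 1, by push_cast; module⟩))
    obtain ⟨l1, -, -⟩ := i3 (p - 1) (p - m) (q - n)
      (by rw [← hmn] at hpq; linear_combination (norm := module) -hpq)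
    have hp : p = 1 := sub_eq_zero.1 l1
    have hq : q = 1 := by rw [sub_eq_zero.1 k3, ← sub_eq_zero.1 k1, hp]
    rw [hp, hq, one_smul, one_smul, add_assoc] at hpq
    exact add_left_cancel hpq
  have hW2 : ∀ x : W, ∃ y : W, (y : V) ∉ span F {(x : V)} := by
    intro x
    obtain ⟨z, hz⟩ := hV e x
    obtain ⟨y, hy, w, hw, rfl⟩ := Submodule.mem_sup.1 (hW.sup_eq_top ▸ mem_top : z ∈ span F {e} ⊔ W)
    refine ⟨⟨w, hw⟩, fun hmem => hz (Submodule.add_mem _ (span_singleton_le_span_pair _ _ hy) ?_)⟩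
    exact span_mono (by simp) hmem
  -- For dependent `u`, `v`, adding a third vector `t` off their line reduces to the independent
  -- case.
  have h_add' : ∀ u v : W, h (u + v) = h u + h v := by
    intro u v
    by_cases hv : (v : V) ∈ span F {(u : V)}
    · obtain ⟨t, ht⟩ := hW2 u
      have hle : span F {(v : V)} ≤ span F {(u : V)} := by simpa using hv
      have hle' : span F {((u + v : W) : V)} ≤ span F {(u : V)} := by
        simpa using Submodule.add_mem _ (mem_span_singleton_self (u : V)) hv
      have e1 := h_add (u + v) t (fun hm => ht (hle' hm))
      have e2 := h_add u (v + t) (by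
        push_cast
        rwa [Submodule.add_mem_iff_right _ hv])
      rw [h_add v t (fun hm => ht (hle hm)), ← add_assoc, e1, ← add_assoc] at e2
      exact add_right_cancel e2
    · exact h_add u v hv
  obtain ⟨hh, hhh⟩ : ∃ hh : W →+ V, ∀ v, hh v = h v :=
    ⟨AddMonoidHom.mk' h h_add', fun _ => rfl⟩
  have coe_mem : ∀ u v : W, v ∈ span F {u} ↔ (v : V) ∈ span F {(u : V)} := by
    intro u v
    rw [mem_span_singleton, mem_span_singleton]
    simp only [← SetLike.coe_eq_coe, SetLike.val_smul]
  have hW2' : ∀ x : W, ∃ y : W, y ∉ span F {x} := by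
    intro x
    obtain ⟨y, hy⟩ := hW2 x
    exact ⟨y, (coe_mem _ _).not.2 hy⟩
  have hh_smul : ∀ (c : F) (v : W), ∃ s : F, hh (c • v) = s • hh v := by
    intro c v
    have := h_mem v v (c • v) (by
      rw [Set.pair_eq_singleton]; exact smul_mem_span_singleton c (v : V))
    rw [Set.pair_eq_singleton] at this
    obtain ⟨s, hs⟩ := mem_span_singleton.1 this
    exact ⟨s, by rw [hhh, hhh, hs]⟩
  have hh_ind : ∀ u v : W, u ≠ 0 → v ∉ span F {u} → hh u ≠ 0 ∧ hh v ∉ span F {hh u} := by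
    intro u v hu hv
    rw [hhh, hhh]
    refine ⟨h_ne u hu, fun hm => h_ind u v hu ((coe_mem _ _).not.1 hv) ?_⟩
    exact span_mono (by simp) hm
  obtain ⟨σ, hσ⟩ := exists_ringHom_of_map_smul hW2' hh hh_smul hh_ind
  have hσ' : ∀ (c : F) (v : W), h (c • v) = σ c • h v := by
    intro c v
    rw [← hhh, hσ, hhh]
  have dec : ∀ v : V, ∃ (a : F) (w : W), v = a • e + w := by
    intro v
    obtain ⟨y, hy, w, hw, rfl⟩ := Submodule.mem_sup.1 (hW.sup_eq_top ▸ mem_top : v ∈ span F {e} ⊔ W)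
    obtain ⟨a, rfl⟩ := mem_span_singleton.1 hy
    exact ⟨a, ⟨w, hw⟩, rfl⟩
  choose A w hAw using dec
  have uniq : ∀ (a b : F) (x y : W), a • e + (x : V) = b • e + y → a = b ∧ x = y := by
    intro a b x y hxy
    have h1 : (x : V) - y = 0 := by
      refine hWe _ (W.sub_mem x.2 y.2) (mem_span_singleton.2 ⟨b - a, ?_⟩)
      linear_combination (norm := module) -hxy
    have h2 := sub_eq_zero.1 h1
    rw [h2] at hxy
    exact ⟨smul_left_injective F he (add_right_cancel hxy), Subtype.ext h2⟩
  have hHadd : ∀ x y : V, A (x + y) = A x + A y ∧ w (x + y) = w x + w y := by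
    intro x y
    apply uniq
    rw [← hAw, add_smul]
    push_cast
    conv_lhs => rw [hAw x, hAw y]
    abel
  have hHsmul : ∀ (c : F) (x : V), A (c • x) = c * A x ∧ w (c • x) = c • w x := by
    intro c x
    apply uniq
    rw [← hAw, mul_smul, SetLike.val_smul, ← smul_add, ← hAw]
  -- The twist `σ` found on `W` also dictates the values on the line of `e`: `a • e + w ↦ σ a • φ e
  -- + h w`.
  refine ⟨AddMonoidHom.mk' (fun v => σ (A v) • φ e + h (w v)) ?_, σ, ?_, ?_⟩
  · intro x y
    rw [(hHadd x y).1, (hHadd x y).2, map_add, h_add', add_smul]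
    abel
  · intro c v
    simp only [AddMonoidHom.mk'_apply]
    rw [(hHsmul c v).1, (hHsmul c v).2, map_mul, hσ', smul_add, smul_smul]
  · intro v
    simp only [AddMonoidHom.mk'_apply]
    by_cases hA : A v = 0
    · obtain ⟨c, h1, h2⟩ := hc (w v)
      refine ⟨c, h1, ?_⟩
      have : v = w v := by
        conv_lhs => rw [hAw v, hA, zero_smul, zero_add]
      rw [hA, map_zero, zero_smul, zero_add, h2, ← this]
    · have hv : v = A v • (e + ((A v)⁻¹ • w v : W)) := by
        rw [smul_add, SetLike.val_smul, smul_inv_smul₀ hA]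
        exact hAw v
      obtain ⟨a, h1, h2⟩ := ha ((A v)⁻¹ • w v)
      have hmem : φ (e + ((A v)⁻¹ • w v : W)) ∈ span F {φ v} := by
        rw [← hφ1]
        refine mem_span_singleton.2 ⟨(A v)⁻¹, ?_⟩
        nth_rewrite 2 [hv]
        rw [inv_smul_smul₀ hA]
      obtain ⟨b, hb⟩ := mem_span_singleton.1 hmem
      have hsA : σ (A v) ≠ 0 := (map_ne_zero σ).2 hA
      have hb0 : b ≠ 0 := by
        rintro rfl
        rw [zero_smul] at hb
        have := (hφz _).1 hb.symm
        rw [this, smul_zero] at hv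
        have hA0 : A 0 = 0 := by simpa using (hHsmul 0 0).1
        rw [hv] at hA
        exact hA hA0
      refine ⟨σ (A v) * a⁻¹ * b, mul_ne_zero (mul_ne_zero hsA (inv_ne_zero h1)) hb0, ?_⟩
      rw [mul_smul, hb, h2, hσ', map_inv₀, smul_smul, mul_assoc, inv_mul_cancel₀ h1, mul_one,
        smul_add, smul_inv_smul₀ hsA]

end FundamentalTheorem

/-! ### Independence of multiplicative characters -/

section Characters

variable {F : Type u} [Field F]

/-- Dedekind's independence of characters, in a form where `χ₁`, `χ₂`, `χ₃` may coincide with each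
other: only `χ₀` has to differ from the rest. -/
theorem coeff_eq_zero_of_characters {G : Type v} [Monoid G] {χ₀ χ₁ χ₂ χ₃ : G →* F}
    (h₁ : χ₀ ≠ χ₁) (h₂ : χ₀ ≠ χ₂) (h₃ : χ₀ ≠ χ₃) {a₀ a₁ a₂ a₃ : F}
    (h : ∀ c, a₀ * χ₀ c = a₁ * χ₁ c + a₂ * χ₂ c + a₃ * χ₃ c) : a₀ = 0 := by
  by_contra ha
  have hli := linearIndependent_monoidHom G F
  refine hli.notMem_span_image (s := {χ₁, χ₂, χ₃}) (x := χ₀) (by simp [h₁, h₂, h₃]) ?_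
  have heq : (χ₀ : G → F) = a₀⁻¹ • (a₁ • ⇑χ₁ + a₂ • ⇑χ₂ + a₃ • ⇑χ₃) := by
    ext c
    have := h c
    simp only [Pi.smul_apply, Pi.add_apply, smul_eq_mul]
    rw [← this, inv_mul_cancel_left₀ ha]
  rw [heq]
  have hm : ∀ χ ∈ ({χ₁, χ₂, χ₃} : Set (G →* F)),
      (χ : G → F) ∈ span F ((fun f : G →* F => (f : G → F)) '' {χ₁, χ₂, χ₃}) :=
    fun χ hχ => subset_span ⟨χ, hχ, rfl⟩
  exact smul_mem _ _ (add_mem (add_mem (smul_mem _ _ (hm _ (by simp)))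
    (smul_mem _ _ (hm _ (by simp)))) (smul_mem _ _ (hm _ (by simp))))

theorem exists_unit_ne_one (hF : Nat.card F ≠ 2) : ∃ a : Fˣ, a ≠ 1 := by
  obtain ⟨a, b, h⟩ := exists_units_add_eq_one hF
  refine ⟨a, ?_⟩
  rintro rfl
  simp at h

end Characters

/-! ### Semilinear maps lying locally in the span of `1` and `A` -/

section Pencil

variable {F : Type u} [Field F] {V : Type v} [AddCommGroup V] [Module F V]

/-- Evaluating `B` at `u + c • A u` and comparing coefficients of `u`, `A u`, `A (A u)` yields a
relation with nonzero coefficients between the characters `c`, `1`, `τ c`, `τ c / σ c` of `Fˣ`. By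
independence, no one of them can differ from the three others; the only possible coincidences give
`τ = id` and `τ = σ`. -/
theorem ringHom_eq_id_of_triple (hF : Nat.card F ≠ 2) {A B : V →+ V} {σ τ : F →+* F}
    (hA : ∀ (c : F) (v : V), A (c • v) = σ c • A v) (hB : ∀ (c : F) (v : V), B (c • v) = τ c • B v)
    (hAB : ∀ x, ∃ f g : F, f ≠ 0 ∧ g ≠ 0 ∧ B x = f • x + g • A x) {u : V} (hu : u ≠ 0)
    (hAu : A u ∉ span F {u}) (hAAu : A (A u) ∉ span F {u, A u}) (c : F) : σ c = c := by
  obtain ⟨f, g, hf, hg, hu1⟩ := hAB u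
  obtain ⟨f₁, g₁, hf₁, hg₁, hu2⟩ := hAB (A u)
  let ι : Fˣ →* F := Units.coeHom F
  let τ' : Fˣ →* F := (τ : F →* F).comp ι
  let θ : Fˣ →* F := ι.comp (Units.map (τ : F →* F) / Units.map (σ : F →* F))
  have hθ : ∀ c : Fˣ, θ c = τ c * (σ c)⁻¹ := by
    intro c
    simp [θ, ι, div_eq_mul_inv]
  have key : ∀ c : Fˣ, f * ι c = g * (1 : Fˣ →* F) c + f₁ * τ' c + (-g₁) * θ c := by
    intro c
    obtain ⟨f₂, g₂, -, -, h3⟩ := hAB (u + (c : F) • A u)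
    rw [map_add, map_add, hB, hA, hu1, hu2] at h3
    have hσ0 : σ c ≠ 0 := (map_ne_zero σ).2 c.ne_zero
    obtain ⟨k1, k2, k3⟩ := eq_zero_of_triple hu hAu hAAu (a := f - f₂)
      (b := g + τ c * f₁ - f₂ * c - g₂) (c := τ c * g₁ - g₂ * σ c)
      (by linear_combination (norm := module) h3)
    rw [hθ]
    change f * (c : F) = g * 1 + f₁ * τ c + (-g₁) * (τ c * (σ c)⁻¹)
    field_simp
    linear_combination (-σ c) * k2 + σ c * c * k1 + k3
  obtain ⟨d, hd⟩ := exists_unit_ne_one hF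
  have hd' : (d : F) ≠ 1 := by simpa using hd
  have hι : ι ≠ 1 := fun h => hd' (DFunLike.congr_fun h d)
  have hτ1 : τ' ≠ 1 := fun h => hd' (τ.injective (by
    rw [map_one]; exact DFunLike.congr_fun h d))
  -- If `τ' ≠ ι`, one of the two is isolated: `τ'` when `ι = θ`, and `ι` otherwise.
  have hτ : τ' = ι := by
    by_contra hne
    by_cases hιθ : ι = θ
    · refine hf₁ (coeff_eq_zero_of_characters hne (hιθ ▸ hne) hτ1 (a₁ := f) (a₂ := g₁) (a₃ := -g)
        fun c => ?_)
      linear_combination -key c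
    · exact hf (coeff_eq_zero_of_characters hι (Ne.symm hne) hιθ key)
  have hτc : ∀ c : Fˣ, τ c = c := fun c => DFunLike.congr_fun hτ c
  -- With `τ' = ι`, the equality `θ = ι` would mean `σ d = 1` with `d ≠ 1`; so `θ` can only coincide
  -- with `1`.
  have hθ1 : θ = 1 := by
    by_contra hne
    refine hg₁ (coeff_eq_zero_of_characters (χ₁ := ι) (χ₂ := τ') (χ₃ := 1) (a₁ := -f) (a₂ := f₁)
      (a₃ := g) ?_ ?_ hne fun c => ?_)
    · intro h
      have h1 : θ d = d := DFunLike.congr_fun h d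
      rw [hθ, hτc, mul_eq_left₀ d.ne_zero, inv_eq_one, ← map_one σ] at h1
      exact hd' (σ.injective h1)
    · intro h
      have h1 : θ d = τ' d := DFunLike.congr_fun h d
      rw [hτ] at h1
      change θ d = d at h1
      rw [hθ, hτc, mul_eq_left₀ d.ne_zero, inv_eq_one, ← map_one σ] at h1
      exact hd' (σ.injective h1)
    · linear_combination key c
  by_cases hc : c = 0
  · rw [hc, map_zero]
  · have h1 : θ (Units.mk0 c hc) = 1 := DFunLike.congr_fun hθ1 _
    rw [hθ, hτc] at h1
    exact (eq_of_div_eq_one (by rw [div_eq_mul_inv]; exact h1)).symm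

/-- With four independent vectors, expanding `B (u + c • v)` shows that the coefficients at `u` and
`v` agree (take `c = 1`), and then that `τ c = c` and `τ c = σ c`. -/
theorem ringHom_eq_id_of_quadruple {A B : V →+ V} {σ τ : F →+* F}
    (hA : ∀ (c : F) (v : V), A (c • v) = σ c • A v) (hB : ∀ (c : F) (v : V), B (c • v) = τ c • B v)
    (hAB : ∀ x, ∃ f g : F, f ≠ 0 ∧ g ≠ 0 ∧ B x = f • x + g • A x) {u v : V}
    (hind : ∀ a b c d : F, a • u + b • A u + c • v + d • A v = 0 →
      a = 0 ∧ b = 0 ∧ c = 0 ∧ d = 0) (c : F) : σ c = c := by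
  obtain ⟨f, g, hf, hg, hu⟩ := hAB u
  obtain ⟨f₁, g₁, hf₁, hg₁, hv⟩ := hAB v
  have key : ∀ c : F, f₁ * τ c = f * c ∧ g₁ * τ c = g * σ c := by
    intro c
    obtain ⟨f₂, g₂, -, -, h3⟩ := hAB (u + c • v)
    rw [map_add, map_add, hB, hA, hu, hv] at h3
    obtain ⟨k1, k2, k3, k4⟩ := hind (f - f₂) (g - g₂) (τ c * f₁ - f₂ * c) (τ c * g₁ - g₂ * σ c)
      (by linear_combination (norm := module) h3)
    exact ⟨by linear_combination k3 - c * k1, by linear_combination k4 - σ c * k2⟩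
  have h1 := key 1
  simp only [map_one, mul_one] at h1
  have h2 := key c
  rw [← h1.1, ← h1.2] at h2
  rw [← mul_left_cancel₀ hg₁ h2.2, mul_left_cancel₀ hf₁ h2.1]

theorem exists_ne_ne (hF : Nat.card F ≠ 2) (a : F) : ∃ t : F, t ≠ 0 ∧ t ≠ a := by
  by_cases ha : a = 1
  · obtain ⟨d, hd⟩ := exists_unit_ne_one hF
    exact ⟨d, d.ne_zero, by simpa [ha] using hd⟩
  · exact ⟨1, one_ne_zero, Ne.symm ha⟩

/-- A linear map in the local span of `1` and `A` that has a nontrivial kernel vanishes, if `A` has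
no eigenvectors. -/
theorem eq_zero_of_map_eq_zero (hF : Nat.card F ≠ 2) (hV : ∀ x y : V, ∃ z, z ∉ span F {x, y})
    {A B : V →ₗ[F] V} (hA : ∀ (x : V), x ≠ 0 → A x ∉ span F {x})
    (hAB : ∀ x, B x ∈ span F {x, A x}) {x : V} (hx : x ≠ 0) (hBx : B x = 0) : B = 0 := by
  have key : ∀ y, y ∉ span F {x, A x} → B y = 0 := by
    intro y hy
    have hy0 : y ≠ 0 := by rintro rfl; simp at hy
    obtain ⟨f, g, hfg⟩ := mem_span_pair.1 (hAB y)
    have hAx := hA x hx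
    -- As `B x = 0`, adding `t • x` to `y` does not change the value of `B`, so `B y` lies in a
    -- whole family of planes as `t` varies.
    have hFG : ∀ t : F, ∃ f' g' : F, f • y + g • A y = f' • (y + t • x) + g' • (A y + t • A x) := by
      intro t
      obtain ⟨f', g', h⟩ := mem_span_pair.1 (hAB (y + t • x))
      refine ⟨f', g', ?_⟩
      rw [map_add, map_add, map_smul, map_smul, hBx, smul_zero, add_zero] at h
      rw [hfg, h]
    have i3 := fun (a b c : F) (h : a • x + b • A x + c • y = 0) => eq_zero_of_triple hx hAx hy h
    suffices g = 0 ∧ f = 0 by rw [← hfg, this.1, this.2]; simp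
    by_cases hAy : ∃ α β γ : F, A y = α • x + β • A x + γ • y
    · obtain ⟨α, β, γ, hAy⟩ := hAy
      have hrel : ∀ t : F, ∃ f' g' : F, (g - g') * α = t * f' ∧ (g - g') * β = t * g' ∧
          f - f' = -(g - g') * γ := by
        intro t
        obtain ⟨f', g', h⟩ := hFG t
        rw [hAy] at h
        obtain ⟨k1, k2, k3⟩ := i3 ((g - g') * α - t * f') ((g - g') * β - t * g')
          (f - f' + (g - g') * γ) (by linear_combination (norm := module) h)
        exact ⟨f', g', by linear_combination k1, by linear_combination k2,
          by linear_combination k3⟩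
      -- If `β = 0`, two distinct nonzero values of `t` force `f' = 0`, whence `g • α = 0`; here `α
      -- = 0` would make `y` an eigenvector of `A`.
      by_cases hβ : β = 0
      · subst hβ
        obtain ⟨t, ht0, ht1⟩ := exists_ne_ne hF 1
        obtain ⟨f', g', h1, h2, h3⟩ := hrel 1
        obtain ⟨f'', g'', h1', h2', h3'⟩ := hrel t
        have hg' : g' = 0 := by simpa using h2.symm
        have hg'' : g'' = 0 := by simpa [ht0] using h2'.symm
        subst hg' hg''
        have hff : f' = f'' := by linear_combination h3' - h3
        subst hff
        have hf0 : (t - 1) * f' = 0 := by linear_combination h1 - h1'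
        have hf' : f' = 0 := (mul_eq_zero.1 hf0).resolve_left (sub_ne_zero.2 ht1)
        subst hf'
        have hα : α ≠ 0 := by
          rintro rfl
          exact hA y hy0 (by rw [hAy]; simpa using smul_mem_span_singleton γ y)
        have hg : g = 0 := by simpa [hα] using h1
        exact ⟨hg, by simpa [hg] using h3⟩
      -- At `t = -β` the terms in `g'` cancel and leave `β * g = 0`. A second value of `t`,
      -- different from `0` and `-β`, then gives `f = 0`.
      · obtain ⟨f', g', h1, h2, h3⟩ := hrel (-β)
        have hg : g = 0 := by
          have : β * g = 0 := by linear_combination h2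
          simpa [hβ] using this
        subst hg
        refine ⟨rfl, ?_⟩
        obtain ⟨t, ht0, ht1⟩ := exists_ne_ne hF (-β)
        obtain ⟨f'', g'', h1', h2', h3'⟩ := hrel t
        have hg'' : g'' = 0 := by
          have : (t + β) * g'' = 0 := by linear_combination -h2'
          exact (mul_eq_zero.1 this).resolve_left fun h => ht1 (eq_neg_of_add_eq_zero_left h)
        subst hg''
        have hf'' : f'' = 0 := by simpa [ht0] using h1'.symm
        subst hf''
        simpa using h3'
    · obtain ⟨f', g', h⟩ := hFG 1
      have hgg : g - g' = 0 := by
        by_contra hne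
        refine hAy ⟨(g - g')⁻¹ * f', (g - g')⁻¹ * g', (g - g')⁻¹ * (f' - f), ?_⟩
        have : (g - g') • A y = f' • x + g' • A x + (f' - f) • y := by
          linear_combination (norm := module) h
        rw [← inv_smul_smul₀ hne (A y), this]
        module
      rw [sub_eq_zero] at hgg
      subst hgg
      obtain ⟨k1, k2, k3⟩ := i3 (-f') (-g) (f - f') (by linear_combination (norm := module) h)
      rw [neg_eq_zero] at k1 k2
      exact ⟨k2, by rw [sub_eq_zero.1 k3, k1]⟩
  ext y
  by_cases hy : y ∈ span F {x, A x}
  · obtain ⟨z, hz⟩ := hV x (A x)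
    have := key (y + z) (by rwa [Submodule.add_mem_iff_right _ hy])
    rwa [map_add, key z hz, add_zero] at this
  · exact key y hy

end Pencil

/-- A nearfield `(V, +, mul)` with semilinear left multiplications that is commutative up to
scalars. -/
structure ProjectiveNearfield (F : Type u) [Field F] (V : Type v) [AddCommGroup V]
    [Module F V] where
  one : V
  mul : V → V →+ V
  σ : V → F →+* F
  one_ne_zero : one ≠ 0
  mul_smul : ∀ (w : V) (c : F) (v : V), mul w (c • v) = σ w c • mul w v
  mul_one : ∀ w, mul w one = w
  exists_mul_eq_smul : ∀ w v, ∃ c : F, c ≠ 0 ∧ mul w v = c • mul v w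
  mem_span_one : ∀ (w v : V) (c : F), v ≠ 0 → mul w v = c • v → w ∈ span F {one}
  mul_assoc : ∀ u v w, mul (mul u v) w = mul u (mul v w)

/-! ### Commutativity and bilinearity of the nearfield product -/

namespace ProjectiveNearfield

variable {F : Type u} [Field F] {V : Type v} [AddCommGroup V] [Module F V]
  (N : ProjectiveNearfield F V)

theorem mul_notMem_span {w x : V} (hw : w ∉ span F {N.one}) (hx : x ≠ 0) :
    N.mul w x ∉ span F {x} := fun h => by
  obtain ⟨c, hc⟩ := mem_span_singleton.1 h
  exact hw (N.mem_span_one w x c hx hc.symm)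

theorem exists_mul_one_add (w x : V) :
    ∃ f g : F, f ≠ 0 ∧ g ≠ 0 ∧ N.mul (N.one + w) x = f • x + g • N.mul w x := by
  obtain ⟨c, hc, h⟩ := N.exists_mul_eq_smul (N.one + w) x
  obtain ⟨d, hd, h'⟩ := N.exists_mul_eq_smul x w
  refine ⟨c, c * d, hc, mul_ne_zero hc hd, ?_⟩
  rw [h, map_add, N.mul_one, h']
  module

/-- Either `1`, `w`, `w * w` are independent and the characters argument applies, or the plane of
`1` and `w` is stable under `w`. In the latter case `1`, `w`, `u`, `w * u` are independent for any
`u` off that plane. -/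
theorem σ_eq (hF : Nat.card F ≠ 2) (hV : ∀ x y : V, ∃ z, z ∉ span F {x, y}) {w : V}
    (hw : w ∉ span F {N.one}) (c : F) : N.σ w c = c := by
  by_cases hww : N.mul w (N.mul w N.one) ∈ span F {N.one, N.mul w N.one}
  · rw [N.mul_one] at hww
    obtain ⟨a, b, hab⟩ := mem_span_pair.1 hww
    obtain ⟨u, hu⟩ := hV N.one w
    -- The plane of `u` and `w * u` is also stable: `w * (w * u) = (w * w) * u ∼ u * (w * w)`, and
    -- `w * w` is a combination of `1` and `w`.
    have hinv : ∃ p q : F, N.mul w (N.mul w u) = p • u + q • N.mul w u := by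
      obtain ⟨d, -, hd⟩ := N.exists_mul_eq_smul (N.mul w w) u
      obtain ⟨d', -, hd'⟩ := N.exists_mul_eq_smul u w
      refine ⟨d * N.σ u a, d * N.σ u b * d', ?_⟩
      rw [← N.mul_assoc, hd, ← hab, map_add, N.mul_smul, N.mul_smul, N.mul_one, hd']
      module
    have hu0 : u ≠ 0 := by rintro rfl; simp at hu
    have h1 := N.mul_notMem_span hw N.one_ne_zero
    rw [N.mul_one] at h1
    refine ringHom_eq_id_of_quadruple (N.mul_smul w) (N.mul_smul (N.one + w))
      (N.exists_mul_one_add w) (u := N.one) (v := u) ?_ c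
    intro p q r s h
    rw [N.mul_one] at h
    -- A nonzero `z` in both stable planes would be independent of `w * z`, so these two would span
    -- both planes, putting `u` in the first one.
    have hp : r • u + s • N.mul w u = 0 := by
      by_contra hne
      have hz1 : r • u + s • N.mul w u = (-p) • N.one + (-q) • w := by
        linear_combination (norm := module) h
      obtain ⟨z, hz⟩ : ∃ z, z = r • u + s • N.mul w u := ⟨_, rfl⟩
      rw [← hz] at hz1 hne
      have hz2 : z ∈ span F {N.one, w} := by
        rw [hz1]; exact smul_add_smul_mem_span_pair _ _ _ _
      have hz3 : N.mul w z ∈ span F {N.one, w} := by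
        rw [hz1, map_add, N.mul_smul, N.mul_smul, N.mul_one, ← hab]
        exact add_mem (smul_mem _ _ (subset_span (by simp)))
          (smul_mem _ _ (smul_add_smul_mem_span_pair _ _ _ _))
      obtain ⟨p', q', hinv⟩ := hinv
      have hz4 : N.mul w z ∉ span F {z} := N.mul_notMem_span hw hne
      have hz5 : N.mul w z = (N.σ w s * p') • u + (N.σ w r + N.σ w s * q') • N.mul w u := by
        rw [hz, map_add, N.mul_smul, N.mul_smul, hinv]
        module
      have hD : (r * (N.σ w r + N.σ w s * q') - N.σ w s * p' * s) • u =
          (N.σ w r + N.σ w s * q') • z + (-s) • N.mul w z := by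
        rw [hz5, hz]
        module
      by_cases hD0 : r * (N.σ w r + N.σ w s * q') - N.σ w s * p' * s = 0
      · rw [hD0, zero_smul] at hD
        have hs := (eq_zero_of_pair hne hz4 hD.symm).2
        rw [neg_eq_zero] at hs
        subst hs
        have hr : r = 0 := by simpa using hD0
        subst hr
        exact hne (by rw [hz]; simp)
      · refine hu ((Submodule.smul_mem_iff _ hD0).1 ?_)
        rw [hD]
        exact add_mem (smul_mem _ _ hz2) (smul_mem _ _ hz3)
    have hp' := eq_zero_of_pair hu0 (N.mul_notMem_span hw hu0) hp
    have hq' := eq_zero_of_pair N.one_ne_zero h1 (a := p) (b := q)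
      (by linear_combination (norm := module) h - hp)
    exact ⟨hq'.1, hq'.2, hp'.1, hp'.2⟩
  · refine ringHom_eq_id_of_triple hF (N.mul_smul w) (N.mul_smul (N.one + w))
      (N.exists_mul_one_add w) N.one_ne_zero (N.mul_notMem_span hw N.one_ne_zero) hww c

theorem mul_comm_of_notMem (hF : Nat.card F ≠ 2) (hV : ∀ x y : V, ∃ z, z ∉ span F {x, y}) {w : V}
    (hw : w ∉ span F {N.one}) (y : V) : N.mul w y = N.mul y w := by
  have hw' : N.one + w ∉ span F {N.one} := by
    simpa using add_notMem_span_singleton hw (1 : F)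
  let A : V →ₗ[F] V := { N.mul w with
    map_smul' := fun c x => by
      change N.mul w (c • x) = c • N.mul w x
      rw [N.mul_smul, N.σ_eq hF hV hw] }
  let B : V →ₗ[F] V := { N.mul (N.one + w) with
    map_smul' := fun c x => by
      change N.mul (N.one + w) (c • x) = c • N.mul (N.one + w) x
      rw [N.mul_smul, N.σ_eq hF hV hw'] }
  have hAx : ∀ x, A x = N.mul w x := fun _ => rfl
  have hBx : ∀ x, B x = N.mul (N.one + w) x := fun _ => rfl
  have h0 : B - LinearMap.id - A = 0 := by
    refine eq_zero_of_map_eq_zero hF hV (A := A) (fun x hx => N.mul_notMem_span hw hx) ?_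
      N.one_ne_zero ?_
    · intro x
      obtain ⟨f, g, -, -, h⟩ := N.exists_mul_one_add w x
      refine mem_span_pair.2 ⟨f - 1, g - 1, ?_⟩
      simp only [LinearMap.sub_apply, LinearMap.id_apply, hAx, hBx, h]
      module
    · simp only [LinearMap.sub_apply, LinearMap.id_apply, hAx, hBx, N.mul_one]
      abel
  by_cases hy : y = 0
  · subst hy
    obtain ⟨c, -, hc⟩ := N.exists_mul_eq_smul 0 w
    rw [hc, map_zero, smul_zero]
  have h1 : N.mul (N.one + w) y = y + N.mul w y := by
    have := LinearMap.congr_fun h0 y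
    simp only [LinearMap.sub_apply, LinearMap.id_apply, hAx, hBx, LinearMap.zero_apply] at this
    linear_combination (norm := module) this
  obtain ⟨c, hc, h⟩ := N.exists_mul_eq_smul (N.one + w) y
  obtain ⟨d, hd, h'⟩ := N.exists_mul_eq_smul y w
  rw [h1, map_add, N.mul_one, h'] at h
  obtain ⟨k1, k2⟩ := eq_zero_of_pair hy (N.mul_notMem_span hw hy) (a := 1 - c) (b := 1 - c * d)
    (by linear_combination (norm := module) h)
  have hc1 : c = 1 := (sub_eq_zero.1 k1).symm
  have hd1 : d = 1 := by rw [hc1, one_mul] at k2; exact (sub_eq_zero.1 k2).symm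
  rw [h', hd1, one_smul]

/-- The remaining case is that of two multiples of `1`. A scalar `d • 1` commutes with every `t` off
the line of `1`, hence acts on it as `d`; distributing over `e • 1 + z` carries this to the line
itself. -/
theorem mul_comm (hF : Nat.card F ≠ 2) (hV : ∀ x y : V, ∃ z, z ∉ span F {x, y}) (x y : V) :
    N.mul x y = N.mul y x := by
  by_cases hx : x ∈ span F {N.one}
  · by_cases hy : y ∈ span F {N.one}
    · obtain ⟨z, hz⟩ := hV N.one N.one
      rw [Set.pair_eq_singleton] at hz
      obtain ⟨a, rfl⟩ := mem_span_singleton.1 hx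
      obtain ⟨b, rfl⟩ := mem_span_singleton.1 hy
      have h1 : ∀ (d : F) (t : V), t ∉ span F {N.one} → N.mul (d • N.one) t = d • t := by
        intro d t ht
        rw [← N.mul_comm_of_notMem hF hV ht, N.mul_smul, N.mul_one, N.σ_eq hF hV ht]
      have h2 : ∀ d e : F, N.mul (d • N.one) (e • N.one) = (d * e) • N.one := by
        intro d e
        have h3 := h1 d (e • N.one + z) (add_notMem_span_singleton hz e)
        rw [map_add, h1 d z hz, smul_add, smul_smul] at h3
        exact add_right_cancel h3
      rw [h2, h2, _root_.mul_comm]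
    · exact (N.mul_comm_of_notMem hF hV hy x).symm
  · exact N.mul_comm_of_notMem hF hV hx y

/-- Multiplication by `c • 1` is scaling by `c`, so linearity follows from associativity and
commutativity. -/
theorem mul_smul_eq (hF : Nat.card F ≠ 2) (hV : ∀ x y : V, ∃ z, z ∉ span F {x, y}) (c : F)
    (x y : V) : N.mul x (c • y) = c • N.mul x y := by
  obtain ⟨z, hz⟩ := hV N.one N.one
  rw [Set.pair_eq_singleton] at hz
  have h1 : ∀ v, N.mul (c • N.one) v = c • v := by
    intro v
    by_cases hv : v ∈ span F {N.one}
    · have h2 : ∀ t, t ∉ span F {N.one} → N.mul (c • N.one) t = c • t := by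
        intro t ht
        rw [← N.mul_comm_of_notMem hF hV ht, N.mul_smul, N.mul_one, N.σ_eq hF hV ht]
      have h3 := h2 (v + z) (by rwa [Submodule.add_mem_iff_right _ hv])
      rw [map_add, h2 z hz, smul_add] at h3
      exact add_right_cancel h3
    · rw [← N.mul_comm_of_notMem hF hV hv, N.mul_smul, N.mul_one, N.σ_eq hF hV hv]
  rw [← h1 y, ← h1 (N.mul x y), ← N.mul_assoc, N.mul_comm hF hV x, N.mul_assoc]

end ProjectiveNearfield

/-! ### The field structure on `V` -/

namespace ProjectiveNearfield

variable {F : Type u} [Field F] {V : Type v} [AddCommGroup V] [Module F V]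
  (N : ProjectiveNearfield F V)

/-- If `x * y = 0` with `y ≠ 0`, then `y` is an eigenvector with eigenvalue `0`, so `x` is a
multiple of `1` and acts as a scalar. -/
theorem eq_zero_or_eq_zero_of_mul_eq_zero (hF : Nat.card F ≠ 2)
    (hV : ∀ x y : V, ∃ z, z ∉ span F {x, y}) {x y : V} (h : N.mul x y = 0) : x = 0 ∨ y = 0 := by
  by_contra! hxy
  obtain ⟨a, rfl⟩ := mem_span_singleton.1 (N.mem_span_one x y 0 hxy.2 (by rw [h, zero_smul]))
  rw [N.mul_comm hF hV, N.mul_smul_eq hF hV, N.mul_one, smul_eq_zero] at h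
  rcases h with rfl | h
  · exact hxy.1 (zero_smul _ _)
  · exact hxy.2 h

theorem exists_mul_eq_one [FiniteDimensional F V] (hF : Nat.card F ≠ 2)
    (hV : ∀ x y : V, ∃ z, z ∉ span F {x, y}) {x : V} (hx : x ≠ 0) : ∃ y, N.mul x y = N.one := by
  let A : V →ₗ[F] V := { N.mul x with map_smul' := fun c y => N.mul_smul_eq hF hV c x y }
  have hA : Function.Injective A := by
    refine (injective_iff_map_eq_zero A).2 fun y hy => ?_
    exact (N.eq_zero_or_eq_zero_of_mul_eq_zero hF hV hy).resolve_left hx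
  exact LinearMap.surjective_of_injective hA N.one

theorem exists_field [FiniteDimensional F V] (N : ProjectiveNearfield F V) (hF : Nat.card F ≠ 2)
    (hV : ∀ x y : V, ∃ z, z ∉ span F {x, y}) :
    ∃ (K : Type v) (_ : Field K) (_ : Algebra F K), Nonempty (V ≃ₗ[F] K) := by
  classical
  choose! inv hinv using fun (x : V) (hx : x ≠ 0) => N.exists_mul_eq_one hF hV hx
  let _ : Field V :=
    { (inferInstance : AddCommGroup V) with
      mul := fun x y => N.mul x y
      one := N.one
      mul_assoc := N.mul_assoc
      one_mul := fun x => (N.mul_comm hF hV _ _).trans (N.mul_one x)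
      mul_one := N.mul_one
      mul_comm := N.mul_comm hF hV
      left_distrib := fun x y z => map_add (N.mul x) y z
      right_distrib := fun x y z => by
        change N.mul (x + y) z = N.mul x z + N.mul y z
        rw [N.mul_comm hF hV, map_add, N.mul_comm hF hV z, N.mul_comm hF hV z]
      zero_mul := fun x => (N.mul_comm hF hV _ _).trans (map_zero _)
      mul_zero := fun x => map_zero (N.mul x)
      inv := fun x => if x = 0 then 0 else inv x
      exists_pair_ne := ⟨N.one, 0, N.one_ne_zero⟩
      mul_inv_cancel := fun x hx => by
        change N.mul x (if x = 0 then 0 else inv x) = N.one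
        rw [if_neg hx, hinv x hx]
      inv_zero := if_pos rfl
      nnqsmul := _
      nnqsmul_def := fun _ _ => rfl
      qsmul := _
      qsmul_def := fun _ _ => rfl }
  let _ : Algebra F V := Algebra.ofModule
    (fun r x y => by
      change N.mul (r • x) y = r • N.mul x y
      rw [N.mul_comm hF hV, N.mul_smul_eq hF hV, N.mul_comm hF hV])
    (fun r x y => N.mul_smul_eq hF hV r x y)
  exact ⟨V, inferInstance, inferInstance, ⟨LinearEquiv.refl F V⟩⟩

end ProjectiveNearfield

/-! ### The factor hyperfield modulo `Fˣ` and the hypergroup of the projective space -/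

section FactorIso

variable {F : Type u} [Field F] {V : Type v} [AddCommGroup V] [Module F V]
  {K : Type u} [Field K] [Algebra F K]

theorem mk_baseUnits_eq_iff {x y : K} :
    Factor.mk (baseUnits F K) x = Factor.mk (baseUnits F K) y ↔ ∃ a : Fˣ, x = a • y := by
  rw [Factor.mk_eq_iff]
  constructor
  · rintro ⟨_, ⟨a, rfl⟩, h⟩
    exact ⟨a, by rw [← h, Units.smul_def, Algebra.smul_def]; rfl⟩
  · rintro ⟨a, rfl⟩
    exact ⟨_, ⟨a, rfl⟩, by rw [Units.smul_def, Algebra.smul_def]; rfl⟩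

theorem mem_hadd_baseUnits {x y z : K} :
    Factor.mk (baseUnits F K) z ∈ Factor.hadd (baseUnits F K) (Factor.mk _ x) (Factor.mk _ y) ↔
      ∃ a b : Fˣ, z = a • x + b • y := by
  rw [Factor.mem_hadd_mk]
  constructor
  · rintro ⟨_, ⟨a, rfl⟩, _, ⟨b, rfl⟩, h⟩
    exact ⟨a, b, by
      rw [h, Units.smul_def, Units.smul_def, Algebra.smul_def, Algebra.smul_def, mul_comm x,
        mul_comm y]
      rfl⟩
  · rintro ⟨a, b, rfl⟩
    exact ⟨_, ⟨a, rfl⟩, _, ⟨b, rfl⟩, by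
      rw [Units.smul_def, Units.smul_def, Algebra.smul_def, Algebra.smul_def, mul_comm x,
        mul_comm y]
      rfl⟩

theorem factorHyperfield_isKVectorSpace (hF : Nat.card F ≠ 2) :
    (factorHyperfield K (baseUnits F K)).toCanonicalHypergroup.IsKVectorSpace := by
  intro X
  obtain ⟨x, rfl⟩ := X.exists_rep
  ext Z
  obtain ⟨z, rfl⟩ := Z.exists_rep
  change _ ∈ Factor.hadd _ _ _ ↔ _ = Factor.mk _ 0 ∨ _ = Factor.mk _ _
  rw [mem_hadd_baseUnits, Factor.mk_eq_zero, mk_baseUnits_eq_iff]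
  constructor
  · rintro ⟨a, b, rfl⟩
    rw [Units.smul_def, Units.smul_def, ← add_smul]
    by_cases hab : (a : F) + b = 0
    · left
      rw [hab, zero_smul]
    · exact Or.inr ⟨Units.mk0 _ hab, rfl⟩
  · rintro (rfl | ⟨c, rfl⟩)
    · exact ⟨1, -1, by simp⟩
    · obtain ⟨a, b, hab⟩ := exists_units_add_eq_one hF
      refine ⟨c * a, c * b, ?_⟩
      rw [Units.smul_def, Units.smul_def, Units.smul_def, ← add_smul, Units.val_mul, Units.val_mul,
        ← mul_add, hab, mul_one]

/-- An `F`-linear isomorphism of `V` with an extension field `K` of `F` induces an isomorphism of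
the hypergroup of `ℙ(V)` with the factor hyperfield of `K` modulo `Fˣ`. -/
theorem nonempty_iso_factorHyperfield (hF : Nat.card F ≠ 2) (e : V ≃ₗ[F] K) :
    Nonempty (CanonicalHypergroup.Iso (projHypergroup V hF)
      (factorHyperfield K (baseUnits F K)).toCanonicalHypergroup) := by
  let f : Option (Projectivization F V) → Factor K (baseUnits F K) :=
    fun x => Factor.mk _ (e (optRep x))
  have hsmul : ∀ (a : Fˣ) (v : V), e (a • v) = a • e v := fun a v => map_smul e (a : F) v
  have hf : Function.Bijective f := by
    constructor
    · intro x y hxy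
      obtain ⟨a, ha⟩ := mk_baseUnits_eq_iff.1 hxy
      rw [← hsmul] at ha
      exact optRep_eq_of_smul a (e.injective ha)
    · intro Y
      obtain ⟨y, rfl⟩ := Y.exists_rep
      obtain ⟨x, a, h⟩ := exists_optRep (F := F) (e.symm y)
      refine ⟨x, mk_baseUnits_eq_iff.2 ⟨a, ?_⟩⟩
      rw [h, hsmul, e.apply_symm_apply]
  refine ⟨{ Equiv.ofBijective f hf with map_zero := ?_, map_hadd := ?_ }⟩
  · change Factor.mk _ (e 0) = Factor.mk _ 0
    rw [map_zero]
  · intro x y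
    change f '' projHadd x y = Factor.hadd _ (f x) (f y)
    ext Z
    obtain ⟨z, rfl⟩ := hf.2 Z
    rw [hf.1.mem_set_image, mem_projHadd hF, mem_hadd_baseUnits]
    simp only [← hsmul, ← map_add, e.injective.eq_iff]

end FactorIso

/-! ### From collineations to spans of representatives -/

section Translations

variable {F : Type u} [Field F] {V : Type v} [AddCommGroup V] [Module F V]

theorem mem_line_iff {x y z : Projectivization F V} (hxy : x ≠ y) :
    z ∈ line x y ↔ z.rep ∈ span F {x.rep, y.rep} := by
  constructor
  · rintro (⟨a, b, h⟩ | rfl | rfl)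
    · rw [h]
      exact smul_add_smul_mem_span_pair _ _ _ _
    · exact subset_span (by simp)
    · exact subset_span (by simp)
  · intro h
    obtain ⟨a, b, h⟩ := mem_span_pair.1 h
    by_cases ha : a = 0
    · subst ha
      rw [zero_smul, zero_add] at h
      have hb : b ≠ 0 := by
        rintro rfl
        exact z.rep_nonzero (by rw [← h, zero_smul])
      have : some z = some y := optRep_eq_of_smul (Units.mk0 b hb) h.symm
      right; right
      exact Option.some.inj this
    · by_cases hb : b = 0
      · subst hb
        rw [zero_smul, add_zero] at h
        have : some z = some x := optRep_eq_of_smul (Units.mk0 a ha) h.symm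
        right; left
        exact Option.some.inj this
      · exact Or.inl ⟨Units.mk0 a ha, Units.mk0 b hb, h.symm⟩

theorem eq_of_rep_mem_span {x y : Projectivization F V} (h : x.rep ∈ span F {y.rep}) : x = y := by
  obtain ⟨a, h⟩ := mem_span_singleton.1 h
  have ha : a ≠ 0 := by
    rintro rfl
    exact x.rep_nonzero (by rw [← h, zero_smul])
  exact Option.some.inj (optRep_eq_of_smul (x := some x) (y := some y) (Units.mk0 a ha) h.symm)

/-- For `z ≠ x` on the line of distinct points `x`, `y`, the lines `ℓ(x, z)` and `ℓ(x, y)` coincide,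
hence so do their images under `β`, and the image of `z` lies on the former. -/
theorem rep_mem_span_of_isCollineation {α : Projectivization F V → Projectivization F V}
    {β : lines F V → lines F V} (h : IsCollineation α β) {x y z : Projectivization F V}
    (hz : z.rep ∈ span F {x.rep, y.rep}) : (α z).rep ∈ span F {(α x).rep, (α y).rep} := by
  by_cases hxy : x = y
  · subst hxy
    rw [Set.pair_eq_singleton] at hz
    rw [eq_of_rep_mem_span hz]
    exact subset_span (by simp)
  by_cases hzx : z = x
  · rw [hzx]
    exact subset_span (by simp)
  have hspan : span F {x.rep, z.rep} = span F {x.rep, y.rep} := by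
    refine le_antisymm (span_le.2 ?_) (span_le.2 ?_)
    · rintro _ (rfl | rfl)
      · exact subset_span (by simp)
      · exact hz
    · rintro _ (rfl | rfl)
      · exact subset_span (by simp)
      · obtain ⟨a, b, hab⟩ := mem_span_pair.1 hz
        have hb : b ≠ 0 := by
          rintro rfl
          rw [zero_smul, add_zero] at hab
          exact hzx (eq_of_rep_mem_span (mem_span_singleton.2 ⟨a, hab⟩))
        refine (Submodule.smul_mem_iff _ hb).1 ?_
        rw [← eq_sub_iff_add_eq'] at hab
        rw [hab]
        exact sub_mem (subset_span (by simp)) (smul_mem _ _ (subset_span (by simp)))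
  have hline : line x z = line x y := by
    ext w
    rw [mem_line_iff (Ne.symm hzx), mem_line_iff hxy, hspan]
  have h1 := h.2.2 x z (Ne.symm hzx)
  have h2 := h.2.2 x y hxy
  have h3 : line (α x) (α z) = line (α x) (α y) := by
    rw [h1, h2]
    congr 2
    exact Subtype.ext hline
  rw [← mem_line_iff (h.1.1.ne hxy), ← h3]
  exact Or.inr (Or.inr rfl)

theorem span_rep {v : V} (hv : v ≠ 0) :
    span F {(Projectivization.mk F v hv).rep} = span F {v} := by
  obtain ⟨a, ha⟩ := Projectivization.exists_smul_eq_mk_rep F v hv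
  rw [← ha]
  exact span_singleton_group_smul_eq F a v

theorem span_pair_rep {v w : V} (hv : v ≠ 0) (hw : w ≠ 0) :
    span F {(Projectivization.mk F v hv).rep, (Projectivization.mk F w hw).rep} =
      span F {v, w} := by
  rw [span_insert, span_insert, span_rep, span_rep]

theorem mk_eq_mk_of_smul {v w : V} (hv : v ≠ 0) (hw : w ≠ 0) {c : F} (h : v = c • w) :
    Projectivization.mk F v hv = Projectivization.mk F w hw :=
  (Projectivization.mk_eq_mk_iff' F v w hv hw).2 ⟨c, h.symm⟩

open Classical in
/-- The product of the points represented by `w` and `v`, as a vector. -/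
noncomputable def repMul [Mul (Projectivization F V)] (w v : V) : V :=
  if h : w ≠ 0 ∧ v ≠ 0 then (Projectivization.mk F w h.1 * Projectivization.mk F v h.2).rep else 0

/-! ### Lifting the translations to a projective nearfield -/

section Mul

variable [CommGroup (Projectivization F V)]

theorem repMul_of_ne_zero {w v : V} (hw : w ≠ 0) (hv : v ≠ 0) :
    repMul (F := F) w v = (Projectivization.mk F w hw * Projectivization.mk F v hv).rep :=
  dif_pos ⟨hw, hv⟩

theorem repMul_zero (w : V) : repMul (F := F) w 0 = 0 := dif_neg (by simp)

theorem zero_repMul (v : V) : repMul (F := F) 0 v = 0 := dif_neg (by simp)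

theorem repMul_comm (w v : V) : repMul (F := F) w v = repMul (F := F) v w := by
  by_cases hw : w = 0
  · rw [hw, repMul_zero, zero_repMul]
  by_cases hv : v = 0
  · rw [hv, repMul_zero, zero_repMul]
  rw [repMul_of_ne_zero hw hv, repMul_of_ne_zero hv hw, mul_comm]

theorem repMul_ne_zero {w v : V} (hw : w ≠ 0) (hv : v ≠ 0) : repMul (F := F) w v ≠ 0 := by
  rw [repMul_of_ne_zero hw hv]
  exact Projectivization.rep_nonzero _

/-- The converse direction is the forward one for the translation by the inverse point. Zero vectors
represent no point and are treated apart. -/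
theorem mem_span_pair_iff_repMul
    (h : ∀ a : Projectivization F V, ∃ β : lines F V → lines F V,
      IsCollineation (fun x => a * x) β) {w : V} (hw : w ≠ 0) (x y z : V) :
    z ∈ span F {x, y} ↔
      repMul (F := F) w z ∈ span F {repMul (F := F) w x, repMul (F := F) w y} := by
  have key : ∀ x y z : V, x ≠ 0 → y ≠ 0 → (z ∈ span F {x, y} ↔
      repMul (F := F) w z ∈ span F {repMul (F := F) w x, repMul (F := F) w y}) := by
    intro x y z hx hy
    by_cases hz : z = 0
    · simp [hz, repMul_zero]
    rw [repMul_of_ne_zero hw hx, repMul_of_ne_zero hw hy, repMul_of_ne_zero hw hz,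
      ← span_pair_rep hx hy]
    have hz' : z ∈ span F {(Projectivization.mk F x hx).rep, (Projectivization.mk F y hy).rep} ↔
        (Projectivization.mk F z hz).rep ∈
          span F {(Projectivization.mk F x hx).rep, (Projectivization.mk F y hy).rep} := by
      rw [← span_singleton_le_iff_mem, ← span_singleton_le_iff_mem, span_rep]
    rw [hz']
    generalize Projectivization.mk F x hx = p
    generalize Projectivization.mk F y hy = q
    generalize Projectivization.mk F z hz = r
    generalize Projectivization.mk F w hw = a
    constructor
    · intro hm
      obtain ⟨β, hβ⟩ := h a
      exact rep_mem_span_of_isCollineation hβ hm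
    · intro hm
      obtain ⟨β, hβ⟩ := h a⁻¹
      simpa using rep_mem_span_of_isCollineation hβ hm
  have hz0 : ∀ z, repMul (F := F) w z = 0 ↔ z = 0 := fun z =>
    ⟨fun h => by_contra fun hz => repMul_ne_zero hw hz h, fun h => by rw [h, repMul_zero]⟩
  by_cases hx : x = 0
  · subst hx
    by_cases hy : y = 0
    · subst hy
      simp [repMul_zero, hz0]
    · have := key y y z hy hy
      rw [Set.pair_eq_singleton, Set.pair_eq_singleton] at this
      rw [repMul_zero, span_insert_zero, span_insert_zero, this]
  · by_cases hy : y = 0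
    · subst hy
      have := key x x z hx hx
      rw [Set.pair_eq_singleton, Set.pair_eq_singleton] at this
      rw [repMul_zero, Set.pair_comm, span_insert_zero, Set.pair_comm, span_insert_zero, this]
    · exact key x y z hx hy

theorem exists_mul_lift (hV : ∀ x y : V, ∃ z, z ∉ span F {x, y})
    (h : ∀ a : Projectivization F V, ∃ β : lines F V → lines F V,
      IsCollineation (fun x => a * x) β) (w : V) :
    ∃ (H : V →+ V) (σ : F →+* F), (∀ (c : F) (v : V), H (c • v) = σ c • H v) ∧
      H (1 : Projectivization F V).rep = w ∧
      ∀ v, ∃ c : F, c ≠ 0 ∧ H v = c • repMul (F := F) w v := by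
  by_cases hw : w = 0
  · subst hw
    exact ⟨0, RingHom.id F, by simp, by simp, fun v => ⟨1, one_ne_zero, by simp [zero_repMul]⟩⟩
  obtain ⟨H, σ, hσ, hH⟩ := exists_semilinear_lift hV (repMul (F := F) w) (repMul_zero w)
    (mem_span_pair_iff_repMul h hw)
  obtain ⟨c, hc, hc'⟩ := hH (1 : Projectivization F V).rep
  rw [repMul_of_ne_zero hw (Projectivization.rep_nonzero _), Projectivization.mk_rep, mul_one]
    at hc'
  obtain ⟨a, ha⟩ := Projectivization.exists_smul_eq_mk_rep F w hw
  rw [← ha] at hc'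
  have hca : c * a ≠ 0 := mul_ne_zero hc a.ne_zero
  -- The lift sends the chosen representative of the neutral point to `(c * a) • w`. Dividing by `c
  -- * a` normalises this value and leaves `σ` unchanged, since `F` is commutative.
  refine ⟨(DistribSMul.toAddMonoidHom V (c * (a : F))⁻¹).comp H, σ, ?_, ?_, ?_⟩
  · intro d v
    simp only [AddMonoidHom.comp_apply, DistribSMul.toAddMonoidHom_apply]
    rw [hσ, smul_comm]
  · simp only [AddMonoidHom.comp_apply, DistribSMul.toAddMonoidHom_apply]
    rw [hc', Units.smul_def, smul_smul c, inv_smul_smul₀ hca]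
  · intro v
    obtain ⟨d, hd, hd'⟩ := hH v
    refine ⟨(c * (a : F))⁻¹ * d, mul_ne_zero (inv_ne_zero hca) hd, ?_⟩
    simp only [AddMonoidHom.comp_apply, DistribSMul.toAddMonoidHom_apply]
    rw [hd', smul_smul]

theorem nonempty_projectiveNearfield (hV : ∀ x y : V, ∃ z, z ∉ span F {x, y})
    (h : ∀ a : Projectivization F V, ∃ β : lines F V → lines F V,
      IsCollineation (fun x => a * x) β) : Nonempty (ProjectiveNearfield F V) := by
  choose mul σ hσ hone hmul using exists_mul_lift hV h
  have hV1 : ∀ x : V, ∃ y, y ∉ span F {x} := fun x => by simpa using hV x x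
  have h_ne : ∀ w v, w ≠ 0 → v ≠ 0 → mul w v ≠ 0 := by
    intro w v hw hv
    obtain ⟨c, hc, hc'⟩ := hmul w v
    rw [hc']
    exact smul_ne_zero hc (repMul_ne_zero hw hv)
  have h_mk : ∀ w v (hw : w ≠ 0) (hv : v ≠ 0), Projectivization.mk F (mul w v) (h_ne w v hw hv) =
      Projectivization.mk F w hw * Projectivization.mk F v hv := by
    intro w v hw hv
    obtain ⟨c, hc, hc'⟩ := hmul w v
    rw [repMul_of_ne_zero hw hv] at hc'
    rw [mk_eq_mk_of_smul _ (Projectivization.rep_nonzero _) hc', Projectivization.mk_rep]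
  have h_zero : ∀ v, mul 0 v = 0 := by
    intro v
    obtain ⟨c, hc, hc'⟩ := hmul 0 v
    rw [hc', zero_repMul, smul_zero]
  refine ⟨{
    one := (1 : Projectivization F V).rep
    mul := mul
    σ := σ
    one_ne_zero := Projectivization.rep_nonzero _
    mul_smul := hσ
    mul_one := hone
    exists_mul_eq_smul := ?_
    mem_span_one := ?_
    mul_assoc := ?_ }⟩
  · intro w v
    obtain ⟨c, hc, hc'⟩ := hmul w v
    obtain ⟨d, hd, hd'⟩ := hmul v w
    refine ⟨c * d⁻¹, mul_ne_zero hc (inv_ne_zero hd), ?_⟩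
    rw [hc', hd', mul_smul, inv_smul_smul₀ hd, repMul_comm]
  · intro w v c hv hwv
    by_cases hw : w = 0
    · rw [hw]; exact zero_mem _
    have h1 := h_mk w v hw hv
    -- A translation with a fixed point is the translation by the neutral element.
    rw [mk_eq_mk_of_smul _ hv hwv, eq_comm, mul_eq_right] at h1
    rw [← h1, span_rep hw]
    exact mem_span_singleton_self w
  · intro u v w
    by_cases hu : u = 0
    · rw [hu, h_zero, h_zero, h_zero]
    by_cases hv : v = 0
    · rw [hv, map_zero, h_zero, map_zero]
    have huv := h_ne u v hu hv
    -- Both sides lift the same translation and take the neutral vector to `mul u v`, so uniqueness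
    -- of lifts gives associativity.
    have heq : (mul u).comp (mul v) = mul (mul u v) := by
      refine addMonoidHom_eq_of_forall_smul (F := F) hV1 _ _ ?_ ?_
        (Projectivization.rep_nonzero (1 : Projectivization F V)) ?_
      · intro x
        by_cases hx : x = 0
        · exact ⟨1, by simp [hx]⟩
        have h1 : Projectivization.mk F (mul u (mul v x)) (h_ne u _ hu (h_ne v x hv hx)) =
            Projectivization.mk F (mul (mul u v) x) (h_ne _ x huv hx) := by
          rw [h_mk u _ hu (h_ne v x hv hx), h_mk v x hv hx, h_mk _ x huv hx, h_mk u v hu hv,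
            mul_assoc]
        obtain ⟨c, hc⟩ := (Projectivization.mk_eq_mk_iff' F _ _ _ _).1 h1
        exact ⟨c, hc.symm⟩
      · intro x y hx hy
        refine ⟨h_ne _ x huv hx, fun hm => hy ?_⟩
        by_cases hy0 : y = 0
        · rw [hy0]; exact zero_mem _
        obtain ⟨c, hc⟩ := mem_span_singleton.1 hm
        have h1 := mk_eq_mk_of_smul (h_ne _ y huv hy0) (h_ne _ x huv hx) hc.symm
        rw [h_mk _ y huv hy0, h_mk _ x huv hx, mul_right_inj] at h1
        obtain ⟨d, hd⟩ := (Projectivization.mk_eq_mk_iff' F _ _ _ _).1 h1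
        exact mem_span_singleton.2 ⟨d, hd⟩
      · rw [AddMonoidHom.comp_apply, hone, hone]
    rw [← heq, AddMonoidHom.comp_apply]

end Mul

end Translations

end IncidenceGroups

theorem mainTheorem2 (F : Type u) [Field F] (hF : Nat.card F ≠ 2) (n : ℕ) (hn : 1 < n)
    (h : IncidenceGroups.AdmitsIncidenceAbelianGroup F (Fin (n + 1) → F)) :
    ∃ (k K : Type u) (_ : Field k) (_ : Field K) (_ : Algebra k K),
      Module.finrank k K = n + 1 ∧
      (IncidenceGroups.factorHyperfield K
        (IncidenceGroups.baseUnits k K)).toCanonicalHypergroup.IsKVectorSpace ∧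
      Nonempty (IncidenceGroups.CanonicalHypergroup.Iso
        (IncidenceGroups.projHypergroup (Fin (n + 1) → F) hF)
        (IncidenceGroups.factorHyperfield K
          (IncidenceGroups.baseUnits k K)).toCanonicalHypergroup) ∧
      Nonempty (k ≃+* F) := by
  -- The dimension `n + 1` is at least `3`, so two vectors never span.
  have hV : ∀ x y : Fin (n + 1) → F, ∃ z, z ∉ Submodule.span F {x, y} := by
    classical
    intro x y
    by_contra! hcon
    have h1 : Submodule.span F {x, y} = ⊤ := Submodule.eq_top_iff'.2 hcon
    have h2 := finrank_span_finset_le_card (R := F) {x, y}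
    rw [Set.finrank, Finset.coe_pair, h1, finrank_top, Module.finrank_fin_fun] at h2
    have := h2.trans (Finset.card_le_two (a := x) (b := y))
    omega
  obtain ⟨_, hG⟩ := h
  obtain ⟨N⟩ := IncidenceGroups.nonempty_projectiveNearfield hV hG
  obtain ⟨K, _, _, ⟨e⟩⟩ := N.exists_field hF hV
  exact ⟨F, K, inferInstance, inferInstance, inferInstance,
    by rw [← e.finrank_eq, Module.finrank_fin_fun],
    IncidenceGroups.factorHyperfield_isKVectorSpace hF,
    IncidenceGroups.nonempty_iso_factorHyperfield hF e, ⟨RingEquiv.refl F⟩⟩
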